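/- **Setting.** A unit has pretreatment confounders $X$, a treatment $A$ and a mediator $M$ with finitely many levels, posttreatment confounders $Z$, an outcome $Y$, and integrable potential outcomes $Y(a',m')$. Assume 1. consistency: $Y=Y(a',m')$ whenever $A=a'$, $M=m'$; 2. sequential ignorability: $Y(a',m')\perp A\mid X$ and $Y(a',m')\perp M\mid X,A,Z$ for all $a',m'$; 3. positivity: there is $\epsilon>0$ with $\Pr[A=a'\mid X]>\epsilon$ and $\Pr[M=m'\mid X,A,Z]>\epsilon$ almost surely, for all $a',m'$. Fix $(a,m)$ and put $\psi_{am}=\mathbb E[Y(a,m)]$. For every $a'$ let $\mu_y(x,a',z,m')=\mathbb E[Y\mid x,a',z,m']$, $\nu_y(x,a')=\mathbb E[\mu_y(X,a',Z,m)\mid X=x,A=a']$, $\pi_{A}(a'\mid x)=\Pr[A=a'\mid x]$, $\pi_M(m'\mid x,a',z)=\Pr[M=m'\mid x,a',z]$; the nuisance functions are $\mu_y(x,z)=\mu_y(x,a,z,m)$, $\nu_y(x)=\nu_y(x,a)$, $\pi_a(x)=\pi_A(a\mid x)$, $\pi_m(x,z)=\pi_M(m\mid x,a,z)$. Let $O_i=(X_i,A_i,Z_i,M_i,Y_i)$,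 $i=1,\dots,n$, be an i.i.d. sample, and $\mathbb P_n$ the sample mean. **Working models.** Let $\mu(x,a',z,m';\beta)$, $\nu(x,a';\eta)$, $p_A(a'\mid x;\alpha)$, $p_M(m'\mid x,a',z;\gamma)$ be measurable parametric working models with finite-dimensional parameters in sets $\Theta_\mu,\Theta_\nu,\Theta_A,\Theta_M$, and let $w_\mu,w_\nu,w_A,w_M$ be measurable vector-valued weights, which may depend on the same arguments as the respective model, with values in the respective parameter space. Fix sets $S\ni a$, $L_A\ni a$ of treatment levels and $T\ni m$, $L_M\ni m$ of mediator levels (fits within a stratum: $S=\{a\}$, $T=\{m\}$; pooled fits: all levels). The estimating functions are $$U_\mu=\mathbb I(A\in S,M\in T)\,(Y-\mu(X,A,Z,M;\beta))\,w_\mu,\qquad U_A=\sum_{l\in L_A}(\mathbb I(A=l)-p_A(l\mid X;\alpha))\,w_A(X,l;\alpha),$$ $$U_M=\mathbb I(A\in S)\sum_{l\in L_M}(\mathbb I(M=l)-p_M(l\mid X,A,Z;\gamma))\,w_M(X,A,Z,l;\gamma),\qquad U_\nu[R]=\mathbb I(A\in S)\,(R-\nu(X,A;\eta))\,w_\nu(X,A;\eta),$$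 where the response $R$ is $R_1=\mu(X,A,Z,m;\beta)$, $R_2=\mathbb I(M=m)Y/p_M(m\mid X,A,Z;\gamma)$ or $R_4=\mu(X,A,Z,m;\beta)+\frac{\mathbb I(M=m)}{p_M(m\mid X,A,Z;\gamma)}(Y-\mu(X,A,Z,m;\beta))$. A working model is *correctly specified* if for some value of its parameter in its parameter set it equals the corresponding true function almost everywhere on the cells used in its fit ($A\in S,M\in T$ for $\mu$; $A\in S$ for $\nu$; levels in $L_A$ for $p_A$; $A\in S$ and levels in $L_M$ for $p_M$). **Estimators.** Write $\mu(X,Z)=\mu(X,a,Z,m;\beta)$, $\nu(X)=\nu(X,a;\eta)$, $p_a(X)=p_A(a\mid X;\alpha)$, $p_m(X,Z)=p_M(m\mid X,a,Z;\gamma)$ and let $$\varphi_1=\nu(X)+\tfrac{\mathbb I(A=a)}{p_a(X)}(\mu(X,Z)-\nu(X)),\qquad \varphi_2=\nu(X)+\tfrac{\mathbb I(A=a)}{p_a(X)}\Big(\tfrac{\mathbb I(M=m)Y}{p_m(X,Z)}-\nu(X)\Big),$$ $$\varphi_3=\tfrac{\mathbb I(A=a)}{p_a(X)}\Big(\mu(X,Z)+\tfrac{\mathbb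 I(M=m)}{p_m(X,Z)}(Y-\mu(X,Z))\Big),\qquad \varphi_4=\nu(X).$$ For $k=1,2,3,4$ the nuisance parameter $\theta$ is $(\beta,\eta,\alpha)$, $(\gamma,\eta,\alpha)$, $(\beta,\gamma,\alpha)$, $(\beta,\gamma,\eta)$, the system $\Psi_k$ of estimating functions is $(U_\mu,U_\nu[R_1],U_A)$, $(U_M,U_\nu[R_2],U_A)$, $(U_\mu,U_M,U_A)$, $(U_\mu,U_M,U_\nu[R_4])$, and $\hat\psi^{\mathrm{dr}_k}_{am}=\mathbb P_n[\varphi_k(O;\hat\theta)]$, where $\hat\theta$ is a measurable solution of $\mathbb P_n[\Psi_k(O;\hat\theta)]=0$ up to $o_p(n^{-1/2})$. **Regularity conditions for $\hat\psi^{\mathrm{dr}_k}_{am}$.** (i) $\hat\theta$ has a probability limit $\theta^*$ (which need not be related to the truth), each block of which is interior to its parameter set. (ii) For each estimating function in $\Psi_k$, as a function of its own parameter with parameters from earlier steps at their limits, the expectation exists on the whole parameter set and vanishes there at no point other than, possibly, the respective block of $\theta^*$. (iii) On a ball around $\theta^*$, $\Psi_k(O;\cdot)$ and $\varphi_k(O;\cdot)$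 are almost surely continuously differentiable with derivatives bounded in norm by an integrable function of $O$. (iv) $\Psi_k(O;\theta^*)$ and $\varphi_k(O;\theta^*)$ have finite second moments. (v) $\mathbb E[\partial_\theta\Psi_k(O;\theta^*)]$ is nonsingular. **Claim.** For each $k$, under assumptions 1-3 and the regularity conditions for $\hat\psi^{\mathrm{dr}_k}_{am}$, the estimator is consistent and asymptotically normal (CAN): $\hat\psi^{\mathrm{dr}_k}_{am}\to\psi_{am}$ in probability and $\sqrt n(\hat\psi^{\mathrm{dr}_k}_{am}-\psi_{am})\to N(0,v_k)$ in distribution, with $$v_k=\operatorname{Var}\big[\varphi_k(O;\theta^*)-\psi_{am}-\mathbb E[\partial_\theta\varphi_k(O;\theta^*)]\,\mathbb E[\partial_\theta\Psi_k(O;\theta^*)]^{-1}\Psi_k(O;\theta^*)\big],$$ provided that 1. for $k=1$: $\mu$ is correctly specified and either $\nu$ or $p_A$ is correctly specified; 2. for $k=2$: $p_M$ is correctly specified and either $\nu$ or $p_A$ is correctly specified; 3. for $k=3$: $p_A$ is correctly specified and either $p_M$ or $\mu$ is correctly specified; 4. for $k=4$: $\nu$ is correctly specified and either $p_M$ or $\mu$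 is correctly specified. (The remaining working models may be misspecified. $N(0,0)$ denotes the point mass at $0$.) -/

import Mathlib

open MeasureTheory ProbabilityTheory Filter Topology
open scoped NNReal ENNReal

namespace CRF

/-! ### The population: observed variables and potential outcomes -/

/-- One generic unit: pretreatment confounders `X`, treatment `A`, posttreatment confounders `Z`,
mediator `M`, observed outcome `Y`, potential outcomes `Ypot a m = Y(a, m)`.  The fields other than
the variables themselves are measurability and existence of the means. -/
structure Population (Ω 𝒳 𝒜 𝒵 ℳ : Type*) [MeasurableSpace Ω] [MeasurableSpace 𝒳]
    [MeasurableSpace 𝒜] [MeasurableSpace 𝒵] [MeasurableSpace ℳ] (P : Measure Ω) where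
  X : Ω → 𝒳
  A : Ω → 𝒜
  Z : Ω → 𝒵
  M : Ω → ℳ
  Y : Ω → ℝ
  Ypot : 𝒜 → ℳ → Ω → ℝ
  measurable_X : Measurable X
  measurable_A : Measurable A
  measurable_Z : Measurable Z
  measurable_M : Measurable M
  measurable_Y : Measurable Y
  measurable_Ypot : ∀ a m, Measurable (Ypot a m)
  integrable_Ypot : ∀ a m, Integrable (Ypot a m) P

/-- Observed data of one unit, `O = (X, A, Z, M, Y)`. -/
abbrev Obs (𝒳 𝒜 𝒵 ℳ : Type*) := 𝒳 × 𝒜 × 𝒵 × ℳ × ℝ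

namespace Population

variable {Ω 𝒳 𝒜 𝒵 ℳ : Type*} [MeasurableSpace Ω] [MeasurableSpace 𝒳]
  [MeasurableSpace 𝒜] [MeasurableSpace 𝒵] [MeasurableSpace ℳ] {P : Measure Ω}

def XA (V : Population Ω 𝒳 𝒜 𝒵 ℳ P) (ω : Ω) : 𝒳 × 𝒜 := (V.X ω, V.A ω)

def XAZ (V : Population Ω 𝒳 𝒜 𝒵 ℳ P) (ω : Ω) : 𝒳 × 𝒜 × 𝒵 := (V.X ω, V.A ω, V.Z ω)

def XAZM (V : Population Ω 𝒳 𝒜 𝒵 ℳ P) (ω : Ω) : 𝒳 × 𝒜 × 𝒵 × ℳ :=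
  (V.X ω, V.A ω, V.Z ω, V.M ω)

def obs (V : Population Ω 𝒳 𝒜 𝒵 ℳ P) (ω : Ω) : Obs 𝒳 𝒜 𝒵 ℳ :=
  (V.X ω, V.A ω, V.Z ω, V.M ω, V.Y ω)

/-- The law of the observed data of one unit. -/
noncomputable def law (V : Population Ω 𝒳 𝒜 𝒵 ℳ P) : Measure (Obs 𝒳 𝒜 𝒵 ℳ) := P.map V.obs

theorem measurable_XAZ (V : Population Ω 𝒳 𝒜 𝒵 ℳ P) : Measurable V.XAZ :=
  V.measurable_X.prodMk (V.measurable_A.prodMk V.measurable_Z)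

/-- The controlled response function `ψ_am = E[Y(a, m)]`. -/
noncomputable def psi (V : Population Ω 𝒳 𝒜 𝒵 ℳ P) (a : 𝒜) (m : ℳ) : ℝ := ∫ ω, V.Ypot a m ω ∂P

/-- `E[Y | x, a', z, m']`, as a function of `(x, a', z, m')`.
At `a' = a`, `m' = m` it is `μ_y(x, z)`. -/
noncomputable def muY [IsFiniteMeasure P] (V : Population Ω 𝒳 𝒜 𝒵 ℳ P)
    (v : 𝒳 × 𝒜 × 𝒵 × ℳ) : ℝ :=
  ∫ y, y ∂(condDistrib V.Y V.XAZM P v)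

/-- `E_{Z | x, a'} E[Y | x, a', Z, m]`, as a function of `(x, a')`.
At `a' = a` it is `ν_y(x)`. -/
noncomputable def nuY [IsFiniteMeasure P] [StandardBorelSpace 𝒵] [Nonempty 𝒵]
    (V : Population Ω 𝒳 𝒜 𝒵 ℳ P) (m : ℳ) (v : 𝒳 × 𝒜) : ℝ :=
  ∫ z, V.muY (v.1, v.2, z, m) ∂(condDistrib V.Z V.XA P v)

/-- `Pr[A = a' | x]`.  At `a' = a` it is `π_a(x)`. -/
noncomputable def piA [IsFiniteMeasure P] [StandardBorelSpace 𝒜] [Nonempty 𝒜]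
    (V : Population Ω 𝒳 𝒜 𝒵 ℳ P) (x : 𝒳) (a' : 𝒜) : ℝ :=
  (condDistrib V.A V.X P x).real {a'}

/-- `Pr[M = m' | x, a', z]`, as a function of `(x, a', z)`.
At `a' = a`, `m' = m` it is `π_m(x, z)`. -/
noncomputable def piM [IsFiniteMeasure P] [StandardBorelSpace ℳ] [Nonempty ℳ]
    (V : Population Ω 𝒳 𝒜 𝒵 ℳ P) (v : 𝒳 × 𝒜 × 𝒵) (m' : ℳ) : ℝ :=
  (condDistrib V.M V.XAZ P v).real {m'}

/-- Consistency: if `A = a` and `M = m`, then `Y = Y(a, m)`. -/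
def Consistency (V : Population Ω 𝒳 𝒜 𝒵 ℳ P) : Prop :=
  ∀ a m, ∀ᵐ ω ∂P, V.A ω = a → V.M ω = m → V.Y ω = V.Ypot a m ω

/-- Sequential ignorability: `Y(a, m) ⫫ A | X` and `Y(a, m) ⫫ M | X, A, Z` for all `a`, `m`. -/
def SequentialIgnorability [StandardBorelSpace Ω] [IsFiniteMeasure P]
    (V : Population Ω 𝒳 𝒜 𝒵 ℳ P) : Prop :=
  (∀ a m, CondIndepFun (MeasurableSpace.comap V.X inferInstance) V.measurable_X.comap_le
      (V.Ypot a m) V.A P) ∧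
  (∀ a m, CondIndepFun (MeasurableSpace.comap V.XAZ inferInstance) V.measurable_XAZ.comap_le
      (V.Ypot a m) V.M P)

/-- Positivity: `p(a' | x)` and `p(m' | x, a', z)` are bounded below by some `ε > 0`, for all
levels `a'`, `m'` and almost all values of the conditioning variables. -/
def Positivity [IsFiniteMeasure P] [StandardBorelSpace 𝒜] [Nonempty 𝒜]
    [StandardBorelSpace ℳ] [Nonempty ℳ] (V : Population Ω 𝒳 𝒜 𝒵 ℳ P) : Prop :=
  ∃ ε : ℝ, 0 < ε ∧
    (∀ a', ∀ᵐ x ∂(P.map V.X), ε < V.piA x a') ∧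
    (∀ m', ∀ᵐ v ∂(P.map V.XAZ), ε < V.piM v m')

end Population

/-! ### Working models and the estimating functions that fit them -/

/-- Finite-dimensional parameters. -/
abbrev Par (d : ℕ) := EuclideanSpace ℝ (Fin d)

/-- Parametric working models for the four nuisance functions at a fixed `(a, m)`.

Each model comes with a parameter set `Θ`, a regression function, and a vector-valued weight
(a score or instrument, for instance the vector of regressors of a generalized linear model) for its
estimating equation.  The models for `μ_y`, `ν_y`, `π_m` are fitted on the units with
`A ∈ S`, the model for `μ_y` moreover only on those with `M ∈ T`: `S = {a}`, `T = {m}` are fits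
within the stratum of interest, `S = T = univ` are regressions pooled over treatment and mediator.
The propensity models use the indicators of the levels in `LA`, `LM`: `LA = {a}` is a binary
regression of `𝟙(A = a)`, `LA = univ` a categorical regression such as multinomial logit. -/
structure WorkingModels (𝒳 : Type*) {𝒜 : Type*} (𝒵 : Type*) {ℳ : Type*} [MeasurableSpace 𝒳]
    [MeasurableSpace 𝒜] [MeasurableSpace 𝒵] [MeasurableSpace ℳ] (a : 𝒜) (m : ℳ) where
  S : Finset 𝒜
  T : Finset ℳ
  LA : Finset 𝒜
  LM : Finset ℳ
  a_mem_S : a ∈ S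
  m_mem_T : m ∈ T
  a_mem_LA : a ∈ LA
  m_mem_LM : m ∈ LM
  /-- dimensions of the parameters -/
  dMu : ℕ
  dNu : ℕ
  dA : ℕ
  dM : ℕ
  /-- parameter sets -/
  ΘMu : Set (Par dMu)
  ΘNu : Set (Par dNu)
  ΘA : Set (Par dA)
  ΘM : Set (Par dM)
  /-- working model for `E[Y | x, a', z, m']` -/
  mu : Par dMu → 𝒳 × 𝒜 × 𝒵 × ℳ → ℝ
  wMu : Par dMu → 𝒳 × 𝒜 × 𝒵 × ℳ → Par dMu
  /-- working model for `E_{Z | x, a'} E[Y | x, a', Z, m]` -/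
  nu : Par dNu → 𝒳 × 𝒜 → ℝ
  wNu : Par dNu → 𝒳 × 𝒜 → Par dNu
  /-- working model for `Pr[A = a' | x]` -/
  pA : Par dA → 𝒳 → 𝒜 → ℝ
  wA : Par dA → 𝒳 → 𝒜 → Par dA
  /-- working model for `Pr[M = m' | x, a', z]` -/
  pM : Par dM → 𝒳 × 𝒜 × 𝒵 → ℳ → ℝ
  wM : Par dM → 𝒳 × 𝒜 × 𝒵 → ℳ → Par dM
  measurable_mu : Measurable (Function.uncurry mu)
  measurable_wMu : Measurable (Function.uncurry wMu)
  measurable_nu : Measurable (Function.uncurry nu)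
  measurable_wNu : Measurable (Function.uncurry wNu)
  measurable_pA : ∀ a', Measurable (fun q : Par dA × 𝒳 => pA q.1 q.2 a')
  measurable_wA : ∀ a', Measurable (fun q : Par dA × 𝒳 => wA q.1 q.2 a')
  measurable_pM : ∀ m', Measurable (fun q : Par dM × (𝒳 × 𝒜 × 𝒵) => pM q.1 q.2 m')
  measurable_wM : ∀ m', Measurable (fun q : Par dM × (𝒳 × 𝒜 × 𝒵) => wM q.1 q.2 m')

namespace WorkingModels

section Estimating

variable {𝒳 𝒜 𝒵 ℳ : Type*} [MeasurableSpace 𝒳] [MeasurableSpace 𝒜] [MeasurableSpace 𝒵]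
  [MeasurableSpace ℳ] [DecidableEq 𝒜] [DecidableEq ℳ] {a : 𝒜} {m : ℳ}

/-- Estimating function of the model for `μ_y`. -/
noncomputable def scoreMu (W : WorkingModels 𝒳 𝒵 a m) : Obs 𝒳 𝒜 𝒵 ℳ → Par W.dMu → Par W.dMu :=
  fun (x, a', z, m', y) β =>
    if a' ∈ W.S ∧ m' ∈ W.T then
      (y - W.mu β (x, a', z, m')) • W.wMu β (x, a', z, m') else 0

/-- Estimating function of the model for `π_a`. -/
noncomputable def scoreA (W : WorkingModels 𝒳 𝒵 a m) : Obs 𝒳 𝒜 𝒵 ℳ → Par W.dA → Par W.dA :=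
  fun (x, a', _, _, _) α =>
    ∑ l ∈ W.LA, ((if a' = l then (1 : ℝ) else 0) - W.pA α x l) • W.wA α x l

/-- Estimating function of the model for `π_m`. -/
noncomputable def scoreM (W : WorkingModels 𝒳 𝒵 a m) : Obs 𝒳 𝒜 𝒵 ℳ → Par W.dM → Par W.dM :=
  fun (x, a', z, m', _) γ =>
    if a' ∈ W.S then
      ∑ l ∈ W.LM, ((if m' = l then (1 : ℝ) else 0) - W.pM γ (x, a', z) l) • W.wM γ (x, a', z) l
    else 0

/-- Estimating function for the regression of a response `u` on `(X, A)` under the model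
for `ν_y`. -/
noncomputable def scoreNu (W : WorkingModels 𝒳 𝒵 a m) (u : Obs 𝒳 𝒜 𝒵 ℳ → ℝ) :
    Obs 𝒳 𝒜 𝒵 ℳ → Par W.dNu → Par W.dNu :=
  fun o η =>
    if o.2.1 ∈ W.S then
      (u o - W.nu η (o.1, o.2.1)) • W.wNu η (o.1, o.2.1) else 0

/-- Imputed outcome: the response in `ν̂(x; μ̂)`. -/
def respMu (W : WorkingModels 𝒳 𝒵 a m) (β : Par W.dMu) : Obs 𝒳 𝒜 𝒵 ℳ → ℝ :=
  fun (x, a', z, _, _) => W.mu β (x, a', z, m)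

/-- Inverse-probability-weighted outcome: the response in `ν̂(x; π̂_m)`. -/
noncomputable def respM (W : WorkingModels 𝒳 𝒵 a m) (γ : Par W.dM) : Obs 𝒳 𝒜 𝒵 ℳ → ℝ :=
  fun (x, a', z, m', y) => (if m' = m then (1 : ℝ) else 0) * y / W.pM γ (x, a', z) m

/-- Augmented inverse-probability-weighted outcome: the response in `ν̂(x; μ̂, π̂_m)`. -/
noncomputable def respMuM (W : WorkingModels 𝒳 𝒵 a m) (β : Par W.dMu) (γ : Par W.dM) :
    Obs 𝒳 𝒜 𝒵 ℳ → ℝ :=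
  fun (x, a', z, m', y) =>
    W.mu β (x, a', z, m) +
      (if m' = m then (1 : ℝ) else 0) / W.pM γ (x, a', z) m * (y - W.mu β (x, a', z, m))

/-! The four systems of estimating equations for the nuisance parameters, and the function whose
sample mean, at the estimated nuisance parameters, is the estimator of `ψ_am`. -/

/-- Nuisance parameters `(β, η, α)` of the models for `μ_y`, `ν_y`, `π_a`. -/
abbrev Par1 (W : WorkingModels 𝒳 𝒵 a m) := Par W.dMu × Par W.dNu × Par W.dA

/-- Nuisance parameters `(γ, η, α)` of the models for `π_m`, `ν_y`, `π_a`. -/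
abbrev Par2 (W : WorkingModels 𝒳 𝒵 a m) := Par W.dM × Par W.dNu × Par W.dA

/-- Nuisance parameters `(β, γ, α)` of the models for `μ_y`, `π_m`, `π_a`. -/
abbrev Par3 (W : WorkingModels 𝒳 𝒵 a m) := Par W.dMu × Par W.dM × Par W.dA

/-- Nuisance parameters `(β, γ, η)` of the models for `μ_y`, `π_m`, `ν_y`. -/
abbrev Par4 (W : WorkingModels 𝒳 𝒵 a m) := Par W.dMu × Par W.dM × Par W.dNu

noncomputable def system1 (W : WorkingModels 𝒳 𝒵 a m) : Obs 𝒳 𝒜 𝒵 ℳ → W.Par1 → W.Par1 :=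
  fun o (β, η, α) => (W.scoreMu o β, W.scoreNu (W.respMu β) o η, W.scoreA o α)

noncomputable def system2 (W : WorkingModels 𝒳 𝒵 a m) : Obs 𝒳 𝒜 𝒵 ℳ → W.Par2 → W.Par2 :=
  fun o (γ, η, α) => (W.scoreM o γ, W.scoreNu (W.respM γ) o η, W.scoreA o α)

noncomputable def system3 (W : WorkingModels 𝒳 𝒵 a m) : Obs 𝒳 𝒜 𝒵 ℳ → W.Par3 → W.Par3 :=
  fun o (β, γ, α) => (W.scoreMu o β, W.scoreM o γ, W.scoreA o α)

noncomputable def system4 (W : WorkingModels 𝒳 𝒵 a m) : Obs 𝒳 𝒜 𝒵 ℳ → W.Par4 → W.Par4 :=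
  fun o (β, γ, η) => (W.scoreMu o β, W.scoreM o γ, W.scoreNu (W.respMuM β γ) o η)

noncomputable def dr1 (W : WorkingModels 𝒳 𝒵 a m) : Obs 𝒳 𝒜 𝒵 ℳ → W.Par1 → ℝ :=
  fun (x, a', z, _, _) (β, η, α) =>
    W.nu η (x, a) + (if a' = a then (1 : ℝ) else 0) / W.pA α x a *
      (W.mu β (x, a, z, m) - W.nu η (x, a))

noncomputable def dr2 (W : WorkingModels 𝒳 𝒵 a m) : Obs 𝒳 𝒜 𝒵 ℳ → W.Par2 → ℝ :=
  fun (x, a', z, m', y) (γ, η, α) =>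
    W.nu η (x, a) + (if a' = a then (1 : ℝ) else 0) / W.pA α x a *
      ((if m' = m then (1 : ℝ) else 0) * y / W.pM γ (x, a, z) m - W.nu η (x, a))

noncomputable def dr3 (W : WorkingModels 𝒳 𝒵 a m) : Obs 𝒳 𝒜 𝒵 ℳ → W.Par3 → ℝ :=
  fun (x, a', z, m', y) (β, γ, α) =>
    (if a' = a then (1 : ℝ) else 0) / W.pA α x a *
      (W.mu β (x, a, z, m) +
        (if m' = m then (1 : ℝ) else 0) / W.pM γ (x, a, z) m * (y - W.mu β (x, a, z, m)))

def dr4 (W : WorkingModels 𝒳 𝒵 a m) : Obs 𝒳 𝒜 𝒵 ℳ → W.Par4 → ℝ :=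
  fun (x, _, _, _, _) (_, _, η) => W.nu η (x, a)

end Estimating

/-! Correct specification: the working model contains the true function, on the cells that are used
in fitting the model (these include the cell of interest). -/

section Correct

variable {Ω 𝒳 𝒜 𝒵 ℳ : Type*} [MeasurableSpace Ω] [MeasurableSpace 𝒳] [MeasurableSpace 𝒜]
  [MeasurableSpace 𝒵] [MeasurableSpace ℳ] {P : Measure Ω} [IsFiniteMeasure P] {a : 𝒜} {m : ℳ}

def MuCorrect (W : WorkingModels 𝒳 𝒵 a m) (V : Population Ω 𝒳 𝒜 𝒵 ℳ P) : Prop :=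
  ∃ β ∈ W.ΘMu, ∀ᵐ v ∂(P.map V.XAZM), v.2.1 ∈ W.S → v.2.2.2 ∈ W.T → W.mu β v = V.muY v

def NuCorrect [StandardBorelSpace 𝒵] [Nonempty 𝒵]
    (W : WorkingModels 𝒳 𝒵 a m) (V : Population Ω 𝒳 𝒜 𝒵 ℳ P) : Prop :=
  ∃ η ∈ W.ΘNu, ∀ᵐ v ∂(P.map V.XA), v.2 ∈ W.S → W.nu η v = V.nuY m v

def PiACorrect [StandardBorelSpace 𝒜] [Nonempty 𝒜]
    (W : WorkingModels 𝒳 𝒵 a m) (V : Population Ω 𝒳 𝒜 𝒵 ℳ P) : Prop :=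
  ∃ α ∈ W.ΘA, ∀ᵐ x ∂(P.map V.X), ∀ l ∈ W.LA, W.pA α x l = V.piA x l

def PiMCorrect [StandardBorelSpace ℳ] [Nonempty ℳ]
    (W : WorkingModels 𝒳 𝒵 a m) (V : Population Ω 𝒳 𝒜 𝒵 ℳ P) : Prop :=
  ∃ γ ∈ W.ΘM, ∀ᵐ v ∂(P.map V.XAZ), v.2.1 ∈ W.S → ∀ l ∈ W.LM, W.pM γ v l = V.piM v l

end Correct

end WorkingModels

/-! ### Estimators defined by estimating equations: regularity conditions and limit notions -/

section Asymptotics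

variable {Ω' 𝒪 E : Type*} [MeasurableSpace Ω'] [MeasurableSpace 𝒪]
  [NormedAddCommGroup E] [NormedSpace ℝ E]

/-- The sample mean `ℙ_n[g]` of `g` over the units `0, …, n - 1`. -/
noncomputable def sampleMean {F : Type*} [AddCommGroup F] [Module ℝ F] (O : ℕ → Ω' → 𝒪) (n : ℕ)
    (ω : Ω') (g : 𝒪 → F) : F :=
  (n : ℝ)⁻¹ • ∑ i ∈ Finset.range n, g (O i ω)

/-- `O 0, O 1, …` is an i.i.d. sample from `Q`. -/
structure IsSample (P' : Measure Ω') (O : ℕ → Ω' → 𝒪) (Q : Measure 𝒪) : Prop where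
  measurable : ∀ i, Measurable (O i)
  indep : iIndepFun O P'
  map_eq : ∀ i, P'.map (O i) = Q

/-- The population estimating equation `E[U(O; θ)] = 0` is well defined on the parameter set `Θ`,
has at most one root in it, namely `θ`, and `θ` is an interior point of `Θ`. -/
structure Identified (Q : Measure 𝒪) (U : 𝒪 → E → E) (Θ : Set E) (θ : E) : Prop where
  interior : θ ∈ interior Θ
  integrable : ∀ t ∈ Θ, Integrable (fun o => U o t) Q
  unique : ∀ t ∈ Θ, ∫ o, U o t ∂Q = 0 → t = θ

/-- The standard smoothness and moment conditions for M-estimation at `θ`, for the system `Ψ` of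
estimating functions and the function `φ` whose sample mean is taken in the last step: both are
continuously differentiable near `θ` with derivatives dominated by an integrable function, have
finite second moments at `θ`, and the expected Jacobian of the system is nonsingular. -/
structure ZRegular (Q : Measure 𝒪) (Ψ : 𝒪 → E → E) (φ : 𝒪 → E → ℝ) (θ : E) : Prop where
  smooth : ∃ r > 0, ∃ G : 𝒪 → ℝ, Integrable G Q ∧ ∀ᵐ o ∂Q,
    ContDiffOn ℝ 1 (Ψ o) (Metric.ball θ r) ∧ ContDiffOn ℝ 1 (φ o) (Metric.ball θ r) ∧
    ∀ t ∈ Metric.ball θ r, ‖fderiv ℝ (Ψ o) t‖ ≤ G o ∧ ‖fderiv ℝ (φ o) t‖ ≤ G o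
  memLp_system : MemLp (fun o => Ψ o θ) 2 Q
  memLp_target : MemLp (fun o => φ o θ) 2 Q
  nonsingular : IsUnit (∫ o, fderiv ℝ (Ψ o) θ ∂Q)

/-- `θhat n` is a (measurable) solution of the sample estimating equations `ℙ_n[Ψ(O; t)] = 0`,
up to `o_p(n^{-1/2})`, and has the probability limit `θ`. -/
structure IsZEstimator [MeasurableSpace E] (P' : Measure Ω') (O : ℕ → Ω' → 𝒪) (Ψ : 𝒪 → E → E)
    (θhat : ℕ → Ω' → E) (θ : E) : Prop where
  measurable : ∀ n, Measurable (θhat n)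
  root : TendstoInMeasure P'
    (fun (n : ℕ) ω => √(n : ℝ) • sampleMean O n ω (fun o => Ψ o (θhat n ω))) atTop (fun _ => 0)
  plim : TendstoInMeasure P' θhat atTop (fun _ => θ)

/-- The plug-in estimator `ℙ_n[φ(O; θhat n)]`. -/
noncomputable def plugIn (O : ℕ → Ω' → 𝒪) (φ : 𝒪 → E → ℝ) (θhat : ℕ → Ω' → E) (n : ℕ) (ω : Ω') :
    ℝ :=
  sampleMean O n ω (fun o => φ o (θhat n ω))

/-- Variance of the influence function
`φ(O; θ) - ψ - E[∂φ(O; θ)] E[∂Ψ(O; θ)]⁻¹ Ψ(O; θ)` of the plug-in estimator. -/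
noncomputable def asympVar (Q : Measure 𝒪) (Ψ : 𝒪 → E → E) (φ : 𝒪 → E → ℝ) (ψ : ℝ) (θ : E) : ℝ≥0 :=
  (Var[fun o => φ o θ - ψ -
    (∫ o', fderiv ℝ (φ o') θ ∂Q) (Ring.inverse (∫ o', fderiv ℝ (Ψ o') θ ∂Q) (Ψ o θ)); Q]).toNNReal

/-- Consistent and asymptotically normal: `ψhat n → ψ` in probability and
`√n (ψhat n - ψ) → N(0, v)` in distribution. -/
def IsCAN (P' : Measure Ω') [IsProbabilityMeasure P'] (ψhat : ℕ → Ω' → ℝ) (ψ : ℝ) (v : ℝ≥0) :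
    Prop :=
  TendstoInMeasure P' ψhat atTop (fun _ => ψ) ∧
  TendstoInDistribution (fun (n : ℕ) ω => √(n : ℝ) * (ψhat n ω - ψ)) atTop (id : ℝ → ℝ)
    (fun _ => P') (gaussianReal 0 v)

end Asymptotics

/-! ### Regularity conditions for the four estimators -/

namespace WorkingModels

variable {𝒳 𝒜 𝒵 ℳ : Type*} [MeasurableSpace 𝒳] [MeasurableSpace 𝒜] [MeasurableSpace 𝒵]
  [MeasurableSpace ℳ] [DecidableEq 𝒜] [DecidableEq ℳ] {a : 𝒜} {m : ℳ}

structure Regular1 (W : WorkingModels 𝒳 𝒵 a m) (Q : Measure (Obs 𝒳 𝒜 𝒵 ℳ)) (θ : W.Par1) :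
    Prop where
  mu : Identified Q W.scoreMu W.ΘMu θ.1
  nu : Identified Q (W.scoreNu (W.respMu θ.1)) W.ΘNu θ.2.1
  piA : Identified Q W.scoreA W.ΘA θ.2.2
  regular : ZRegular Q W.system1 W.dr1 θ

structure Regular2 (W : WorkingModels 𝒳 𝒵 a m) (Q : Measure (Obs 𝒳 𝒜 𝒵 ℳ)) (θ : W.Par2) :
    Prop where
  piM : Identified Q W.scoreM W.ΘM θ.1
  nu : Identified Q (W.scoreNu (W.respM θ.1)) W.ΘNu θ.2.1
  piA : Identified Q W.scoreA W.ΘA θ.2.2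
  regular : ZRegular Q W.system2 W.dr2 θ

structure Regular3 (W : WorkingModels 𝒳 𝒵 a m) (Q : Measure (Obs 𝒳 𝒜 𝒵 ℳ)) (θ : W.Par3) :
    Prop where
  mu : Identified Q W.scoreMu W.ΘMu θ.1
  piM : Identified Q W.scoreM W.ΘM θ.2.1
  piA : Identified Q W.scoreA W.ΘA θ.2.2
  regular : ZRegular Q W.system3 W.dr3 θ

structure Regular4 (W : WorkingModels 𝒳 𝒵 a m) (Q : Measure (Obs 𝒳 𝒜 𝒵 ℳ)) (θ : W.Par4) :
    Prop where
  mu : Identified Q W.scoreMu W.ΘMu θ.1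
  piM : Identified Q W.scoreM W.ΘM θ.2.1
  nu : Identified Q (W.scoreNu (W.respMuM θ.1 θ.2.1)) W.ΘNu θ.2.2
  regular : ZRegular Q W.system4 W.dr4 θ

end WorkingModels

end CRF

open CRF

/-!
A correctly specified working model solves the population version of its estimating equation at the
parameter that gives the true function, so by uniqueness of the zero the limit of the fit yields
the true function on the cells of the fit, and by positivity everywhere. As soon as either the
regression or the propensity in an augmented value is the true one, the error of that value at the
limit `θ` is a combination of residuals with conditional mean zero; hence `𝔼 φₖ(O; θ) = ψ`. The
rest is Z-estimation: a mean value estimate, uniform over shrinking balls, and the weak law of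
large numbers linearize the estimating equations and the target at `θ`, which turns `√n (ψ̂ - ψ)`
into `√n` times the sample mean of the influence function up to `o_p(1)`, and the central limit
theorem and Slutsky's theorem conclude.
-/

namespace CRF

section HighProb

variable {ι Ω F : Type*} [MeasurableSpace Ω] {μ : Measure Ω} {l : Filter ι}

/-- The filter of events whose probability tends to one along `l`: a property of pairs `(i, ω)`
holds eventually along `highProb μ l` if the probability that it fails at `i` tends to zero.
Convergence along this filter is convergence in probability, and `=o[highProb μ l]` is `o_p`. -/
def highProb (μ : Measure Ω) (l : Filter ι) : Filter (ι × Ω) where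
  sets := {S | Tendsto (fun i => μ {ω | (i, ω) ∉ S}) l (𝓝 0)}
  univ_sets := by
    simpa using! tendsto_const_nhds (x := (0 : ℝ≥0∞)) (f := l)
  sets_of_superset hS hST := tendsto_of_tendsto_of_tendsto_of_le_of_le tendsto_const_nhds hS
    (fun _ => zero_le) fun _ => measure_mono fun _ hω hS' => hω (hST hS')
  inter_sets {S T} hS hT := by
    have hsum : Tendsto (fun i => μ {ω | (i, ω) ∉ S} + μ {ω | (i, ω) ∉ T}) l (𝓝 0) := by
      simpa only [add_zero] using Tendsto.add hS hT
    refine tendsto_of_tendsto_of_tendsto_of_le_of_le tendsto_const_nhds hsum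
      (fun _ => zero_le) fun i => (measure_mono fun ω hω => ?_).trans (measure_union_le _ _)
    exact not_and_or.1 hω

theorem eventually_highProb {p : ι × Ω → Prop} :
    (∀ᶠ q in highProb μ l, p q) ↔ Tendsto (fun i => μ {ω | ¬p (i, ω)}) l (𝓝 0) :=
  Iff.rfl

theorem eventually_highProb_of_ae {p : ι × Ω → Prop} (h : ∀ᶠ i in l, ∀ᵐ ω ∂μ, p (i, ω)) :
    ∀ᶠ q in highProb μ l, p q :=
  eventually_highProb.2 (tendsto_const_nhds.congr' (h.mono fun _ hi => (ae_iff.1 hi).symm))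

theorem tendsto_fst_highProb : Tendsto Prod.fst (highProb μ l) l := fun _ hS =>
  eventually_highProb_of_ae (Filter.Eventually.mono hS fun _ hi => ae_of_all _ fun _ => hi)

theorem tendsto_snd_highProb : Tendsto Prod.snd (highProb μ l) (ae μ) := fun _ hS =>
  eventually_highProb_of_ae (.of_forall fun _ => hS)

instance [IsProbabilityMeasure μ] [l.NeBot] : (highProb μ l).NeBot := by
  refine ⟨fun hbot => one_ne_zero (α := ℝ≥0∞) ?_⟩
  have h : ∀ᶠ _ in highProb μ l, False := by simp [hbot]
  have hone : Tendsto (fun _ => 1) l (𝓝 (0 : ℝ≥0∞)) := by simpa using eventually_highProb.1 h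
  exact tendsto_nhds_unique tendsto_const_nhds hone

theorem tendstoInMeasure_const_iff [PseudoEMetricSpace F] {f : ι → Ω → F} {c : F} :
    TendstoInMeasure μ f l (fun _ => c) ↔ Tendsto (Function.uncurry f) (highProb μ l) (𝓝 c) := by
  simp only [TendstoInMeasure, EMetric.tendsto_nhds, eventually_highProb, not_lt,
    Function.uncurry_apply_pair, gt_iff_lt]

/-- A sequence bounded in `L^p` is `O_p(1)`, by Markov's inequality. -/
theorem tendsto_zero_of_isLittleO_of_eLpNorm_le {E : Type*} [NormedAddCommGroup E]
    [NormedAddCommGroup F] {f : ι × Ω → F} {s : ι → Ω → E} {p C : ℝ≥0∞} (hp : p ≠ 0) (hp' : p ≠ ∞)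
    (hs : ∀ i, AEStronglyMeasurable (s i) μ) (hC : C ≠ ∞) (hsC : ∀ i, eLpNorm (s i) p μ ≤ C)
    (h : f =o[highProb μ l] fun q => 1 + ‖s q.1 q.2‖) : Tendsto f (highProb μ l) (𝓝 0) := by
  have htail : Tendsto (fun K : ℝ≥0 => (K : ℝ≥0∞)⁻¹ ^ p.toReal * C ^ p.toReal) atTop (𝓝 0) := by
    have hp0 : 0 < p.toReal := ENNReal.toReal_pos hp hp'
    have hinv : Tendsto (fun K : ℝ≥0 => (K : ℝ≥0∞)⁻¹) atTop (𝓝 0) :=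
      ENNReal.inv_top ▸ tendsto_inv_iff.2 (ENNReal.tendsto_coe_nhds_top.2 tendsto_id)
    simpa [hp0] using ENNReal.Tendsto.mul_const (hinv.ennrpow_const p.toReal)
      (Or.inr (ENNReal.rpow_ne_top_of_nonneg hp0.le hC))
  refine Metric.tendsto_nhds.2 fun ε hε => eventually_highProb.2 (ENNReal.tendsto_nhds_zero.2
    fun η hη => ?_)
  obtain ⟨K, hK, hK0⟩ := ((ENNReal.tendsto_nhds_zero.1 htail (η / 2) (ENNReal.half_pos hη.ne')).and
    (eventually_gt_atTop 0)).exists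
  have hsmall := h.bound (div_pos hε (add_pos one_pos (NNReal.coe_pos.2 hK0)))
  have hratio := ENNReal.tendsto_nhds_zero.1 (eventually_highProb.1 hsmall) (η / 2)
    (ENNReal.half_pos hη.ne')
  filter_upwards [hratio] with i hi
  calc μ {ω | ¬dist (f (i, ω)) 0 < ε}
      ≤ μ ({ω | ¬‖f (i, ω)‖ ≤ ε / (1 + K) * ‖1 + ‖s i ω‖‖} ∪ {ω | (K : ℝ≥0∞) ≤ ‖s i ω‖ₑ}) := by
        refine measure_mono fun ω hω => or_iff_not_imp_right.2 fun hs hf => hω ?_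
        have hs : ‖s i ω‖ < K := by simpa [← NNReal.coe_lt_coe, enorm_eq_nnnorm] using hs
        rw [dist_zero_right]
        calc ‖f (i, ω)‖ ≤ ε / (1 + K) * (1 + ‖s i ω‖) := by
              rwa [Real.norm_of_nonneg (by positivity)] at hf
          _ < ε / (1 + K) * (1 + K) := by gcongr
          _ = ε := div_mul_cancel₀ _ (by positivity)
    _ ≤ η / 2 + η / 2 := by
        refine (measure_union_le _ _).trans (add_le_add hi ?_)
        refine (meas_ge_le_mul_pow_eLpNorm_enorm μ hp hp' (hs i) (by simpa using hK0.ne')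
          (by simp)).trans (le_trans ?_ hK)
        gcongr
        exact hsC i
    _ = η := ENNReal.add_halves η

end HighProb

theorem iSup_mem_eq_iSup_denseSeq {X : Type*} [TopologicalSpace X]
    [TopologicalSpace.SeparableSpace X] [Nonempty X] {U : Set X} {f : X → ℝ≥0∞}
    (hU : IsOpen U) (hf : ContinuousOn f U) :
    ⨆ x ∈ U, f x = ⨆ (n : ℕ) (_ : TopologicalSpace.denseSeq X n ∈ U),
      f (TopologicalSpace.denseSeq X n) := by
  refine le_antisymm (iSup₂_le fun x hx => le_of_forall_lt fun c hc => ?_)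
    (iSup_le fun n => iSup_le fun hn => le_iSup₂_of_le _ hn le_rfl)
  have hnear : {y | y ∈ U ∧ c < f y} ∈ 𝓝 x :=
    inter_mem (hU.mem_nhds hx) ((hf.continuousAt (hU.mem_nhds hx)).eventually (lt_mem_nhds hc))
  obtain ⟨_, ⟨n, rfl⟩, hnU, hcn⟩ :=
    (TopologicalSpace.denseRange_denseSeq X).inter_nhds_nonempty hnear
  exact hcn.trans_le (le_iSup₂_of_le n hnU le_rfl)

section DerivModulus

variable {E F : Type*} [NormedAddCommGroup E] [NormedSpace ℝ E] [NormedAddCommGroup F]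
  [NormedSpace ℝ F] {g : E → F} {θ t : E} {r δ : ℝ}

/-- Modulus of continuity of the derivative of `g` at `θ`; it controls the first-order Taylor
remainder of `g` on the ball of radius `δ`. -/
noncomputable def derivModulus (g : E → F) (θ : E) (δ : ℝ) : ℝ≥0∞ :=
  ⨆ t ∈ Metric.ball θ δ, ‖fderiv ℝ g t - fderiv ℝ g θ‖ₑ

theorem derivModulus_le {C : ℝ} (hδr : δ ≤ r)
    (hC : ∀ t ∈ Metric.ball θ r, ‖fderiv ℝ g t‖ ≤ C) :
    derivModulus g θ δ ≤ ENNReal.ofReal (2 * C) := by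
  refine iSup₂_le fun t ht => ?_
  rw [← ofReal_norm]
  refine ENNReal.ofReal_le_ofReal ((norm_sub_le _ _).trans ?_)
  have ht' := Metric.ball_subset_ball hδr ht
  have hθ := Metric.mem_ball_self (x := θ) (Metric.pos_of_mem_ball ht')
  linarith [hC t ht', hC θ hθ]

theorem norm_sub_sub_fderiv_le_derivModulus
    (hg : ∀ t ∈ Metric.ball θ δ, DifferentiableAt ℝ g t) (hfin : derivModulus g θ δ ≠ ∞)
    (ht : t ∈ Metric.ball θ δ) :
    ‖g t - g θ - fderiv ℝ g θ (t - θ)‖ ≤ (derivModulus g θ δ).toReal * ‖t - θ‖ := by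
  refine (convex_ball θ δ).norm_image_sub_le_of_norm_fderiv_le' hg (fun x hx => ?_)
    (Metric.mem_ball_self (Metric.pos_of_mem_ball ht)) ht
  rw [← toReal_enorm]
  exact ENNReal.toReal_mono hfin (le_iSup₂_of_le x hx le_rfl)

theorem tendsto_derivModulus (hg : ContinuousAt (fderiv ℝ g) θ) :
    Tendsto (derivModulus g θ) (𝓝[>] 0) (𝓝 0) := by
  refine ENNReal.tendsto_nhds_zero.2 fun ε hε => ?_
  have hnear : ∀ᶠ t in 𝓝 θ, ‖fderiv ℝ g t - fderiv ℝ g θ‖ₑ < ε := by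
    simpa only [edist_eq_enorm_sub] using EMetric.tendsto_nhds.1 hg ε hε
  obtain ⟨δ, hδ, hball⟩ := Metric.eventually_nhds_iff_ball.1 hnear
  filter_upwards [Ioo_mem_nhdsGT hδ] with δ' hδ'
  exact iSup₂_le fun t ht => (hball t (Metric.ball_subset_ball hδ'.2.le ht)).le

end DerivModulus

section DominatedDeriv

variable {𝒪 E F : Type*} [MeasurableSpace 𝒪] {Q : Measure 𝒪}
  [NormedAddCommGroup E] [NormedSpace ℝ E] [NormedAddCommGroup F] [NormedSpace ℝ F]
  {Φ : 𝒪 → E → F} {θ : E} {r : ℝ} {G : 𝒪 → ℝ}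

theorem aestronglyMeasurable_fderiv_apply_param
    (hΦ : ∀ t, AEStronglyMeasurable (fun o => Φ o t) Q)
    (hd : ∀ᵐ o ∂Q, DifferentiableAt ℝ (Φ o) θ) (v : E) :
    AEStronglyMeasurable (fun o => fderiv ℝ (Φ o) θ v) Q := by
  refine aestronglyMeasurable_of_tendsto_ae (u := atTop)
    (f := fun (n : ℕ) o => (n : ℝ) • (Φ o (θ + (n : ℝ)⁻¹ • v) - Φ o θ))
    (fun n => ((hΦ _).sub (hΦ _)).const_smul _) ?_
  filter_upwards [hd] with o ho
  exact ho.hasFDerivAt.lim v (tendsto_norm_atTop_atTop.comp tendsto_natCast_atTop_atTop)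

theorem aestronglyMeasurable_fderiv_param [FiniteDimensional ℝ E]
    (hΦ : ∀ t, AEStronglyMeasurable (fun o => Φ o t) Q)
    (hd : ∀ᵐ o ∂Q, DifferentiableAt ℝ (Φ o) θ) :
    AEStronglyMeasurable (fun o => fderiv ℝ (Φ o) θ) Q := by
  let b := Module.finBasis ℝ E
  have hcoord : (fun o => fderiv ℝ (Φ o) θ) = fun o => ∑ i,
      ContinuousLinearMap.smulRightL ℝ E F (LinearMap.toContinuousLinearMap (b.coord i))
        (fderiv ℝ (Φ o) θ (b i)) := by
    ext o v
    conv_lhs => rw [← b.sum_repr v, map_sum]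
    simp
  rw [hcoord]
  exact Finset.aestronglyMeasurable_fun_sum _ fun i _ =>
    (ContinuousLinearMap.continuous _).comp_aestronglyMeasurable
      (aestronglyMeasurable_fderiv_apply_param hΦ hd (b i))

/-- The random function `Φ o`, `o ∼ Q`, is almost surely continuously differentiable on the ball of
radius `r` around `θ`, with derivative dominated by the integrable function `G`: the part of
`ZRegular.smooth` that concerns a single random function. -/
structure DominatedDeriv (Q : Measure 𝒪) (Φ : 𝒪 → E → F) (θ : E) (r : ℝ) (G : 𝒪 → ℝ) : Prop where
  pos : 0 < r
  integrable : Integrable G Q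
  aestronglyMeasurable : ∀ t, AEStronglyMeasurable (fun o => Φ o t) Q
  contDiffOn : ∀ᵐ o ∂Q, ContDiffOn ℝ 1 (Φ o) (Metric.ball θ r)
  norm_fderiv_le : ∀ᵐ o ∂Q, ∀ t ∈ Metric.ball θ r, ‖fderiv ℝ (Φ o) t‖ ≤ G o

namespace DominatedDeriv

theorem differentiableAt (h : DominatedDeriv Q Φ θ r G) :
    ∀ᵐ o ∂Q, ∀ t ∈ Metric.ball θ r, DifferentiableAt ℝ (Φ o) t :=
  h.contDiffOn.mono fun _ ho t ht =>
    (ho.differentiableOn one_ne_zero t ht).differentiableAt (Metric.isOpen_ball.mem_nhds ht)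

theorem continuousOn_fderiv (h : DominatedDeriv Q Φ θ r G) :
    ∀ᵐ o ∂Q, ContinuousOn (fderiv ℝ (Φ o)) (Metric.ball θ r) :=
  h.contDiffOn.mono fun _ ho => ho.continuousOn_fderiv_of_isOpen Metric.isOpen_ball le_rfl

theorem toReal_derivModulus_le (h : DominatedDeriv Q Φ θ r G) :
    ∀ᵐ o ∂Q, ∀ δ ≤ r, (derivModulus (Φ o) θ δ).toReal ≤ 2 * G o :=
  h.norm_fderiv_le.mono fun _ ho _ hδ => ENNReal.toReal_le_of_le_ofReal
    (mul_nonneg zero_le_two ((norm_nonneg _).trans (ho θ (Metric.mem_ball_self h.pos))))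
    (derivModulus_le hδ ho)

theorem norm_sub_sub_fderiv_le (h : DominatedDeriv Q Φ θ r G) {δ : ℝ} (hδ : δ ≤ r) :
    ∀ᵐ o ∂Q, ∀ t ∈ Metric.ball θ δ, ‖Φ o t - Φ o θ - fderiv ℝ (Φ o) θ (t - θ)‖ ≤
      (derivModulus (Φ o) θ δ).toReal * ‖t - θ‖ := by
  filter_upwards [h.differentiableAt, h.norm_fderiv_le] with o hdiff hbound t ht
  exact norm_sub_sub_fderiv_le_derivModulus
    (fun x hx => hdiff x (Metric.ball_subset_ball hδ hx))
    ((derivModulus_le hδ hbound).trans_lt ENNReal.ofReal_lt_top).ne ht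

variable [FiniteDimensional ℝ E]

theorem aestronglyMeasurable_fderiv (h : DominatedDeriv Q Φ θ r G) {t : E}
    (ht : t ∈ Metric.ball θ r) : AEStronglyMeasurable (fun o => fderiv ℝ (Φ o) t) Q :=
  aestronglyMeasurable_fderiv_param h.aestronglyMeasurable
    (h.differentiableAt.mono fun _ ho => ho t ht)

theorem integrable_fderiv (h : DominatedDeriv Q Φ θ r G) :
    Integrable (fun o => fderiv ℝ (Φ o) θ) Q :=
  have hθ := Metric.mem_ball_self h.pos
  h.integrable.mono' (h.aestronglyMeasurable_fderiv hθ) (h.norm_fderiv_le.mono fun _ ho => ho θ hθ)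

theorem aemeasurable_derivModulus (h : DominatedDeriv Q Φ θ r G) {δ : ℝ} (hδ : δ ≤ r) :
    AEMeasurable (fun o => derivModulus (Φ o) θ δ) Q := by
  have := FiniteDimensional.proper_real E
  have hsub : Metric.ball θ δ ⊆ Metric.ball θ r := Metric.ball_subset_ball hδ
  have hmeas : AEMeasurable (fun o => ⨆ (n : ℕ)
      (_ : TopologicalSpace.denseSeq E n ∈ Metric.ball θ δ),
        ‖fderiv ℝ (Φ o) (TopologicalSpace.denseSeq E n) - fderiv ℝ (Φ o) θ‖ₑ) Q :=
    .iSup fun n => .iSup fun hn => ((h.aestronglyMeasurable_fderiv (hsub hn)).sub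
      (h.aestronglyMeasurable_fderiv (Metric.mem_ball_self h.pos))).enorm
  refine hmeas.congr (h.continuousOn_fderiv.mono fun o ho => ?_)
  exact (iSup_mem_eq_iSup_denseSeq Metric.isOpen_ball
    ((ho.mono hsub).sub continuousOn_const).enorm).symm

theorem integrable_derivModulus (h : DominatedDeriv Q Φ θ r G) {δ : ℝ} (hδ : δ ≤ r) :
    Integrable (fun o => (derivModulus (Φ o) θ δ).toReal) Q :=
  (h.integrable.const_mul 2).mono'
    (h.aemeasurable_derivModulus hδ).ennreal_toReal.aestronglyMeasurable
    (h.toReal_derivModulus_le.mono fun _ ho => by simpa using ho δ hδ)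

theorem tendsto_integral_derivModulus (h : DominatedDeriv Q Φ θ r G) :
    Tendsto (fun δ => ∫ o, (derivModulus (Φ o) θ δ).toReal ∂Q) (𝓝[>] 0) (𝓝 0) := by
  have hsmall : ∀ᶠ δ in 𝓝[>] (0 : ℝ), δ ≤ r :=
    mem_of_superset (Ioo_mem_nhdsGT h.pos) fun _ hδ => hδ.2.le
  suffices Tendsto (fun δ => ∫ o, (derivModulus (Φ o) θ δ).toReal ∂Q) (𝓝[>] 0) (𝓝 (∫ _, 0 ∂Q)) by
    simpa using this
  refine tendsto_integral_filter_of_dominated_convergence (fun o => 2 * G o)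
    (hsmall.mono fun δ hδ => (h.integrable_derivModulus hδ).1)
    (hsmall.mono fun δ hδ => h.toReal_derivModulus_le.mono fun _ ho => by simpa using ho δ hδ)
    (h.integrable.const_mul 2) (h.continuousOn_fderiv.mono fun o ho => ?_)
  exact (ENNReal.tendsto_toReal ENNReal.zero_ne_top).comp (tendsto_derivModulus
    (ho.continuousAt (Metric.isOpen_ball.mem_nhds (Metric.mem_ball_self h.pos))))

end DominatedDeriv

end DominatedDeriv

section SampleMean

variable {Ω' 𝒪 E F : Type*} [NormedAddCommGroup E] [NormedSpace ℝ E] [NormedAddCommGroup F]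
  [NormedSpace ℝ F]

theorem sampleMean_sub (O : ℕ → Ω' → 𝒪) (n : ℕ) (ω : Ω') (f g : 𝒪 → F) :
    sampleMean O n ω (fun o => f o - g o) = sampleMean O n ω f - sampleMean O n ω g := by
  simp only [sampleMean, Finset.sum_sub_distrib, smul_sub]

theorem sampleMean_const (O : ℕ → Ω' → 𝒪) {n : ℕ} (hn : n ≠ 0) (ω : Ω') (c : F) :
    sampleMean O n ω (fun _ => c) = c := by
  have : (n : ℝ) ≠ 0 := Nat.cast_ne_zero.2 hn
  simp [sampleMean, ← Nat.cast_smul_eq_nsmul ℝ, smul_smul, this]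

theorem sampleMean_clm_comp (O : ℕ → Ω' → 𝒪) (n : ℕ) (ω : Ω') (f : 𝒪 → E) (L : E →L[ℝ] F) :
    sampleMean O n ω (fun o => L (f o)) = L (sampleMean O n ω f) := by
  simp only [sampleMean, map_smul, map_sum]

theorem sampleMean_clm_apply (O : ℕ → Ω' → 𝒪) (n : ℕ) (ω : Ω') (f : 𝒪 → E →L[ℝ] F) (v : E) :
    sampleMean O n ω (fun o => f o v) = sampleMean O n ω f v := by
  simp only [sampleMean, smul_apply, sum_apply]

theorem norm_sampleMean_le {O : ℕ → Ω' → 𝒪} {n : ℕ} {ω : Ω'} {f : 𝒪 → F} {g : 𝒪 → ℝ} {c : ℝ}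
    (h : ∀ i, ‖f (O i ω)‖ ≤ g (O i ω) * c) :
    ‖sampleMean O n ω f‖ ≤ sampleMean O n ω g * c := by
  simp only [sampleMean, norm_smul, norm_inv, Real.norm_natCast, smul_eq_mul, mul_assoc,
    Finset.sum_mul]
  gcongr
  exact (norm_sum_le _ _).trans (Finset.sum_le_sum fun i _ => h i)

end SampleMean

namespace IsSample

variable {Ω' 𝒪 𝒴 E F : Type*} [MeasurableSpace Ω'] [MeasurableSpace 𝒪] {P' : Measure Ω'}
  {O : ℕ → Ω' → 𝒪} {Q : Measure 𝒪} {f : 𝒪 → ℝ}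

theorem ae_forall (hO : IsSample P' O Q) {p : 𝒪 → Prop} (h : ∀ᵐ o ∂Q, p o) :
    ∀ᵐ ω ∂P', ∀ i, p (O i ω) :=
  ae_all_iff.2 fun i => ae_of_ae_map (hO.measurable i).aemeasurable (by rwa [hO.map_eq i])

theorem identDistrib [MeasurableSpace 𝒴] (hO : IsSample P' O Q) {f : 𝒪 → 𝒴}
    (hf : AEMeasurable f Q) (i : ℕ) :
    IdentDistrib (fun ω => f (O i ω)) (fun ω => f (O 0 ω)) P' P' :=
  IdentDistrib.comp_of_aemeasurable (u := f) ⟨(hO.measurable i).aemeasurable,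
    (hO.measurable 0).aemeasurable, by rw [hO.map_eq, hO.map_eq]⟩ (by rwa [hO.map_eq i])

theorem iIndepFun_comp [MeasurableSpace 𝒴] (hO : IsSample P' O Q) {f : 𝒪 → 𝒴}
    (hf : AEMeasurable f Q) : iIndepFun (fun i ω => f (O i ω)) P' :=
  hO.indep.comp₀ (fun _ => f) (fun i => (hO.measurable i).aemeasurable)
    fun i => by rwa [hO.map_eq i]

theorem variance_comp (hO : IsSample P' O Q) (hf : AEMeasurable f Q) (i : ℕ) :
    Var[fun ω => f (O i ω); P'] = Var[f; Q] := by
  rw [← hO.map_eq i, variance_map (by rwa [hO.map_eq i]) (hO.measurable i).aemeasurable]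
  rfl

variable [NormedAddCommGroup F]

theorem memLp_comp (hO : IsSample P' O Q) {f : 𝒪 → F} {p : ℝ≥0∞} (hf : MemLp f p Q) (i : ℕ) :
    MemLp (fun ω => f (O i ω)) p P' :=
  MemLp.comp_of_map (by rwa [hO.map_eq i]) (hO.measurable i).aemeasurable

variable [NormedSpace ℝ F]

theorem integral_comp (hO : IsSample P' O Q) {f : 𝒪 → F} (hf : AEStronglyMeasurable f Q) (i : ℕ) :
    ∫ ω, f (O i ω) ∂P' = ∫ o, f o ∂Q := by
  rw [← hO.map_eq i, integral_map (hO.measurable i).aemeasurable (by rwa [hO.map_eq i])]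

theorem measurable_sampleMean [MeasurableSpace F] [BorelSpace F] [SecondCountableTopology F]
    [MeasurableSpace E] (hO : IsSample P' O Q) {Φ : 𝒪 → E → F}
    (hΦ : Measurable (Function.uncurry Φ)) {T : Ω' → E} (hT : Measurable T) (n : ℕ) :
    Measurable (fun ω => sampleMean O n ω (fun o => Φ o (T ω))) :=
  (Finset.measurable_sum _ fun i _ =>
    hΦ.comp ((hO.measurable i).prodMk hT)).const_smul ((n : ℝ)⁻¹)

theorem memLp_sampleMean (hO : IsSample P' O Q) {f : 𝒪 → F} {p : ℝ≥0∞} (hf : MemLp f p Q) (n : ℕ) :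
    MemLp (fun ω => sampleMean O n ω f) p P' :=
  (memLp_finsetSum _ fun i _ => hO.memLp_comp hf i).const_smul ((n : ℝ)⁻¹)

theorem integral_sampleMean_eq_zero (hO : IsSample P' O Q) {f : 𝒪 → F} (hf : Integrable f Q)
    (h0 : ∫ o, f o ∂Q = 0) (n : ℕ) : ∫ ω, sampleMean O n ω f ∂P' = 0 := by
  have hint : ∀ i, Integrable (fun ω => f (O i ω)) P' := fun i =>
    memLp_one_iff_integrable.1 (hO.memLp_comp (memLp_one_iff_integrable.2 hf) i)
  simp only [sampleMean, integral_smul, integral_finsetSum _ fun i _ => hint i,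
    hO.integral_comp hf.aestronglyMeasurable, h0, Finset.sum_const_zero, smul_zero]

theorem variance_sqrt_mul_sampleMean_le (hO : IsSample P' O Q) (hf : MemLp f 2 Q) (n : ℕ) :
    Var[fun ω => √(n : ℝ) * sampleMean O n ω f; P'] ≤ Var[f; Q] := by
  have hfm := hf.aestronglyMeasurable.aemeasurable
  have hsum : Var[∑ i ∈ Finset.range n, fun ω => f (O i ω); P'] = n * Var[f; Q] := by
    rw [IndepFun.variance_sum (fun i _ => hO.memLp_comp hf i)
      fun i _ j _ hij => (hO.iIndepFun_comp hfm).indepFun hij]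
    simp only [hO.variance_comp hfm, Finset.sum_const, Finset.card_range, nsmul_eq_mul]
  calc Var[fun ω => √(n : ℝ) * sampleMean O n ω f; P']
      = √(n : ℝ) ^ 2 * ((n : ℝ)⁻¹ ^ 2 * Var[∑ i ∈ Finset.range n, fun ω => f (O i ω); P']) := by
        simp only [sampleMean, smul_eq_mul, variance_const_mul, ← Finset.sum_fn]
    _ = n * ((n : ℝ)⁻¹ ^ 2 * (n * Var[f; Q])) := by rw [hsum, Real.sq_sqrt n.cast_nonneg]
    _ ≤ Var[f; Q] := by
        rcases eq_or_ne n 0 with rfl | hn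
        · simp [variance_nonneg]
        · have : (n : ℝ) ≠ 0 := Nat.cast_ne_zero.2 hn
          exact le_of_eq (by field_simp)

variable [IsProbabilityMeasure P']

theorem isProbabilityMeasure (hO : IsSample P' O Q) : IsProbabilityMeasure Q :=
  hO.map_eq 0 ▸ Measure.isProbabilityMeasure_map (hO.measurable 0).aemeasurable

theorem tendsto_sampleMean [CompleteSpace F] (hO : IsSample P' O Q) {f : 𝒪 → F}
    (hf : Integrable f Q) :
    Tendsto (fun q : ℕ × Ω' => sampleMean O q.1 q.2 f) (highProb P' atTop) (𝓝 (∫ o, f o ∂Q)) := by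
  let _ : MeasurableSpace F := borel F
  have _ : BorelSpace F := ⟨rfl⟩
  have hfm : AEMeasurable f Q := hf.aestronglyMeasurable.aemeasurable
  have hint : ∀ i, Integrable (fun ω => f (O i ω)) P' := fun i =>
    memLp_one_iff_integrable.1 (hO.memLp_comp (memLp_one_iff_integrable.2 hf) i)
  have hlaw := strong_law_ae (fun i ω => f (O i ω)) (hint 0)
    (fun i j hij => (hO.iIndepFun_comp hfm).indepFun hij) (hO.identDistrib hfm)
  rw [hO.integral_comp hf.aestronglyMeasurable 0] at hlaw
  have hmeas : ∀ n, AEStronglyMeasurable (fun ω => sampleMean O n ω f) P' := fun n =>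
    (hO.memLp_sampleMean (memLp_one_iff_integrable.2 hf) n).aestronglyMeasurable
  exact (tendstoInMeasure_const_iff (f := fun n ω => sampleMean O n ω f)).1
    (tendstoInMeasure_of_tendsto_ae hmeas hlaw)

theorem eLpNorm_sqrt_mul_sampleMean_le (hO : IsSample P' O Q) (hf : MemLp f 2 Q)
    (h0 : ∫ o, f o ∂Q = 0) (n : ℕ) :
    eLpNorm (fun ω => √(n : ℝ) * sampleMean O n ω f) 2 P' ≤ ENNReal.ofReal √Var[f; Q] := by
  have := hO.isProbabilityMeasure
  have hmem : MemLp (fun ω => √(n : ℝ) * sampleMean O n ω f) 2 P' :=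
    (hO.memLp_sampleMean hf n).const_mul _
  have hmean : ∫ ω, √(n : ℝ) * sampleMean O n ω f ∂P' = 0 := by
    rw [integral_const_mul, hO.integral_sampleMean_eq_zero (hf.integrable one_le_two) h0, mul_zero]
  rw [hmem.eLpNorm_eq_integral_rpow_norm two_ne_zero ENNReal.ofNat_ne_top]
  refine ENNReal.ofReal_le_ofReal ?_
  have hsq := hO.variance_sqrt_mul_sampleMean_le hf n
  rw [variance_of_integral_eq_zero hmem.aestronglyMeasurable.aemeasurable hmean] at hsq
  simpa only [Real.norm_eq_abs, ENNReal.toReal_ofNat, Real.rpow_ofNat, sq_abs, Real.sqrt_eq_rpow,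
    one_div] using Real.sqrt_le_sqrt hsq

theorem exists_eLpNorm_sqrt_smul_sampleMean_le [FiniteDimensional ℝ F] (hO : IsSample P' O Q)
    {f : 𝒪 → F} (hf : MemLp f 2 Q) (h0 : ∫ o, f o ∂Q = 0) :
    ∃ C ≠ ∞, ∀ n : ℕ, eLpNorm (fun ω => √(n : ℝ) • sampleMean O n ω f) 2 P' ≤ C := by
  have := hO.isProbabilityMeasure
  let b := Module.finBasis ℝ F
  let coord := fun i => LinearMap.toContinuousLinearMap (b.coord i)
  have hcoord : ∀ i, MemLp (fun o => coord i (f o)) 2 Q := fun i => (coord i).comp_memLp' hf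
  have hcoord0 : ∀ i, ∫ o, coord i (f o) ∂Q = 0 := fun i => by
    rw [(coord i).integral_comp_comm (hf.integrable one_le_two), h0, map_zero]
  refine ⟨∑ i, ENNReal.ofReal √Var[fun o => coord i (f o); Q] * ‖b i‖ₑ,
    ENNReal.sum_ne_top.2 fun i _ => by finiteness, fun n => ?_⟩
  have hexpand : (fun ω => √(n : ℝ) • sampleMean O n ω f) = ∑ i, fun ω =>
      (√(n : ℝ) * sampleMean O n ω (fun o => coord i (f o))) • b i := by
    ext ω
    conv_lhs => rw [← b.sum_repr (sampleMean O n ω f)]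
    simp only [Finset.smul_sum, smul_smul, Finset.sum_apply, sampleMean_clm_comp]
    rfl
  have hmeas : ∀ i, AEStronglyMeasurable
      (fun ω => √(n : ℝ) * sampleMean O n ω (fun o => coord i (f o))) P' := fun i =>
    (hO.memLp_sampleMean (hcoord i) n).aestronglyMeasurable.const_mul _
  rw [hexpand]
  refine (eLpNorm_sum_le (fun i _ => (hmeas i).smul_const (b i)) one_le_two).trans
    (Finset.sum_le_sum fun i _ => ?_)
  rw [mul_comm]
  refine (eLpNorm_le_mul_eLpNorm_of_ae_le_mul'' 2 (hmeas i) (.of_forall fun ω => ?_)).trans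
    (mul_le_mul_right (hO.eLpNorm_sqrt_mul_sampleMean_le (hcoord i) (hcoord0 i) n) _)
  rw [enorm_smul, mul_comm]

theorem tendstoInDistribution_sqrt_mul_sampleMean (hO : IsSample P' O Q)
    (hf : MemLp f 2 Q) (h0 : ∫ o, f o ∂Q = 0) :
    TendstoInDistribution (fun (n : ℕ) ω => √(n : ℝ) * sampleMean O n ω f) atTop (id : ℝ → ℝ)
      (fun _ => P') (gaussianReal 0 Var[f; Q].toNNReal) := by
  have hfm := hf.aestronglyMeasurable.aemeasurable
  have hclt := tendstoInDistribution_inv_sqrt_mul_sum_sub (P := P')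
    (P' := gaussianReal 0 Var[f; Q].toNNReal) (X := fun i ω => f (O i ω)) (Y := (id : ℝ → ℝ))
    (by rw [hO.variance_comp hfm 0]; exact HasLaw.id) (hO.memLp_comp hf 0)
    (hO.iIndepFun_comp hfm) (hO.identDistrib hfm)
  simp only [hO.integral_comp hf.aestronglyMeasurable, h0, mul_zero, sub_zero] at hclt
  have hsqrt : ∀ n : ℕ, (√(n : ℝ))⁻¹ = √(n : ℝ) * (n : ℝ)⁻¹ := fun n => by
    rw [← div_eq_mul_inv, Real.sqrt_div_self]
  simpa only [sampleMean, smul_eq_mul, ← mul_assoc, ← hsqrt] using hclt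

end IsSample

section Linearization

open Asymptotics

variable {α E F G : Type*} [NormedAddCommGroup E] [NormedSpace ℝ E] [NormedAddCommGroup F]
  [NormedSpace ℝ F] [NormedAddCommGroup G] [NormedSpace ℝ G] {l : Filter α} {J : E →L[ℝ] F}
  {K : F →L[ℝ] E} {L : E →L[ℝ] G} {a : α → F} {b : α → G} {Δ : α → E}

theorem isBigO_of_isLittleO_sub_clm (hK : Function.LeftInverse K J)
    (ha : (fun x => a x - J (Δ x)) =o[l] Δ) : Δ =O[l] a := by
  have hΔ : Δ =O[l] fun x => J (Δ x) := by
    simpa only [hK _] using K.isBigO_comp (fun x => J (Δ x)) l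
  have hequiv : a ~[l] fun x => J (Δ x) := ha.trans_isBigO hΔ
  exact hΔ.trans hequiv.isBigO_symm

theorem isLittleO_sub_clm_comp (hK : Function.LeftInverse K J)
    (ha : (fun x => a x - J (Δ x)) =o[l] Δ) (hb : (fun x => b x - L (Δ x)) =o[l] Δ) :
    (fun x => b x - L (K (a x))) =o[l] a := by
  refine IsLittleO.trans_isBigO ?_ (isBigO_of_isLittleO_sub_clm hK ha)
  have hLK := ((L.comp K).isBigO_comp (fun x => a x - J (Δ x)) l).trans_isLittleO ha
  refine (hb.sub hLK).congr_left fun x => ?_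
  simp only [ContinuousLinearMap.comp_apply, map_sub, hK _]
  abel

end Linearization

section Expansion

open Asymptotics

variable {Ω' 𝒪 E F : Type*} [MeasurableSpace Ω'] [MeasurableSpace 𝒪] {P' : Measure Ω'}
  [IsProbabilityMeasure P'] {O : ℕ → Ω' → 𝒪} {Q : Measure 𝒪} [NormedAddCommGroup E]
  [NormedSpace ℝ E] [FiniteDimensional ℝ E] [NormedAddCommGroup F] [NormedSpace ℝ F]
  [CompleteSpace F] {Φ : 𝒪 → E → F} {θhat : ℕ → Ω' → E} {θ : E} {r : ℝ} {G : 𝒪 → ℝ}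

theorem DominatedDeriv.isLittleO_sampleMean_sub (h : DominatedDeriv Q Φ θ r G)
    (hO : IsSample P' O Q) (hθ : Tendsto (Function.uncurry θhat) (highProb P' atTop) (𝓝 θ)) :
    (fun q : ℕ × Ω' => sampleMean O q.1 q.2 (fun o => Φ o (θhat q.1 q.2)) -
      sampleMean O q.1 q.2 (fun o => Φ o θ) -
      (∫ o, fderiv ℝ (Φ o) θ ∂Q) (θhat q.1 q.2 - θ))
      =o[highProb P' atTop] fun q => θhat q.1 q.2 - θ := by
  refine isLittleO_iff.2 fun c hc => ?_
  have hsmall : ∀ᶠ δ in 𝓝[>] (0 : ℝ), ∫ o, (derivModulus (Φ o) θ δ).toReal ∂Q < c / 2 :=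
    h.tendsto_integral_derivModulus.eventually_lt_const (half_pos hc)
  obtain ⟨δ, hmodulus, hδ0, hδr⟩ := (hsmall.and (Ioo_mem_nhdsGT h.pos)).exists
  have hmean := (hO.tendsto_sampleMean
    (h.integrable_derivModulus hδr.le)).eventually_lt_const hmodulus
  have hjac := (hO.tendsto_sampleMean h.integrable_fderiv).eventually
    (Metric.ball_mem_nhds _ (half_pos hc))
  have htaylor := hO.ae_forall (h.norm_sub_sub_fderiv_le hδr.le)
  filter_upwards [hmean, hjac, tendsto_snd_highProb.eventually htaylor,
    hθ.eventually (Metric.ball_mem_nhds θ hδ0)] with ⟨n, ω⟩ hmean hjac htaylor hball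
  rw [dist_eq_norm] at hjac
  set J := ∫ o, fderiv ℝ (Φ o) θ ∂Q
  set Δ := θhat n ω - θ
  calc ‖sampleMean O n ω (fun o => Φ o (θhat n ω)) - sampleMean O n ω (fun o => Φ o θ) - J Δ‖
      = ‖sampleMean O n ω (fun o => Φ o (θhat n ω) - Φ o θ - fderiv ℝ (Φ o) θ Δ) +
          (sampleMean O n ω (fun o => fderiv ℝ (Φ o) θ) - J) Δ‖ := by
        rw [sampleMean_sub, sampleMean_sub, sampleMean_clm_apply, sub_apply]
        congr 1
        abel
    _ ≤ c / 2 * ‖Δ‖ + c / 2 * ‖Δ‖ := by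
        refine (norm_add_le _ _).trans (add_le_add ?_ ?_)
        · exact (norm_sampleMean_le fun i => htaylor i _ hball).trans (by gcongr)
        · exact (ContinuousLinearMap.le_opNorm _ _).trans (by gcongr)
    _ = c * ‖Δ‖ := by ring

theorem DominatedDeriv.tendsto_sampleMean_plugIn (h : DominatedDeriv Q Φ θ r G)
    (hO : IsSample P' O Q) (hθ : Tendsto (Function.uncurry θhat) (highProb P' atTop) (𝓝 θ))
    (hint : Integrable (fun o => Φ o θ) Q) :
    Tendsto (fun q : ℕ × Ω' => sampleMean O q.1 q.2 (fun o => Φ o (θhat q.1 q.2)))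
      (highProb P' atTop) (𝓝 (∫ o, Φ o θ ∂Q)) := by
  have hΔ : Tendsto (fun q : ℕ × Ω' => θhat q.1 q.2 - θ) (highProb P' atTop) (𝓝 0) :=
    tendsto_sub_nhds_zero_iff.2 hθ
  have hrem := (h.isLittleO_sampleMean_sub hO hθ).isBigO.trans_tendsto hΔ
  have hlin := ((∫ o, fderiv ℝ (Φ o) θ ∂Q).continuous.tendsto 0).comp hΔ
  rw [map_zero] at hlin
  simpa using (hrem.add hlin).add (hO.tendsto_sampleMean hint)

end Expansion

section RootLimit

variable {Ω' 𝒪 E : Type*} [MeasurableSpace Ω'] {P' : Measure Ω'} {O : ℕ → Ω' → 𝒪}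
  [NormedAddCommGroup E] [NormedSpace ℝ E] [MeasurableSpace E] {Ψ : 𝒪 → E → E}
  {θhat : ℕ → Ω' → E} {θ : E}

namespace IsZEstimator

theorem tendsto (hz : IsZEstimator P' O Ψ θhat θ) :
    Tendsto (Function.uncurry θhat) (highProb P' atTop) (𝓝 θ) :=
  tendstoInMeasure_const_iff.1 hz.plim

theorem tendsto_sqrt_smul (hz : IsZEstimator P' O Ψ θhat θ) :
    Tendsto (fun q : ℕ × Ω' => √(q.1 : ℝ) • sampleMean O q.1 q.2 (fun o => Ψ o (θhat q.1 q.2)))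
      (highProb P' atTop) (𝓝 0) :=
  (tendstoInMeasure_const_iff
    (f := fun (n : ℕ) ω => √(n : ℝ) • sampleMean O n ω (fun o => Ψ o (θhat n ω)))).1 hz.root

theorem tendsto_sampleMean (hz : IsZEstimator P' O Ψ θhat θ) :
    Tendsto (fun q : ℕ × Ω' => sampleMean O q.1 q.2 (fun o => Ψ o (θhat q.1 q.2)))
      (highProb P' atTop) (𝓝 0) := by
  refine squeeze_zero_norm' ?_ (tendsto_zero_iff_norm_tendsto_zero.1 hz.tendsto_sqrt_smul)
  filter_upwards [tendsto_fst_highProb.eventually (eventually_ge_atTop 1)] with q hq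
  rw [norm_smul, Real.norm_of_nonneg (Real.sqrt_nonneg _)]
  exact le_mul_of_one_le_left (norm_nonneg _) (Real.one_le_sqrt.2 (Nat.one_le_cast.2 hq))

end IsZEstimator

end RootLimit

section ZEstimation

open Asymptotics

variable {Ω' 𝒪 E : Type*} [MeasurableSpace 𝒪] {O : ℕ → Ω' → 𝒪} {Q : Measure 𝒪}
  [NormedAddCommGroup E] [NormedSpace ℝ E] {Ψ : 𝒪 → E → E} {φ : 𝒪 → E → ℝ} {ψ : ℝ} {θ : E}

/-- Influence function of the plug-in estimator `ℙ_n[φ(O; θhat n)]`; `asympVar` is its variance. -/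
noncomputable def influence (Q : Measure 𝒪) (Ψ : 𝒪 → E → E) (φ : 𝒪 → E → ℝ) (ψ : ℝ) (θ : E)
    (o : 𝒪) : ℝ :=
  φ o θ - ψ - (∫ o', fderiv ℝ (φ o') θ ∂Q) (Ring.inverse (∫ o', fderiv ℝ (Ψ o') θ ∂Q) (Ψ o θ))

theorem sampleMean_influence {n : ℕ} (hn : n ≠ 0) (ω : Ω') :
    sampleMean O n ω (influence Q Ψ φ ψ θ) =
      sampleMean O n ω (fun o => φ o θ) - ψ - (∫ o, fderiv ℝ (φ o) θ ∂Q)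
        (Ring.inverse (∫ o, fderiv ℝ (Ψ o) θ ∂Q) (sampleMean O n ω (fun o => Ψ o θ))) := by
  unfold influence
  rw [sampleMean_sub, sampleMean_sub, sampleMean_const O hn, sampleMean_clm_comp,
    sampleMean_clm_comp]

namespace ZRegular

theorem memLp_influence [IsFiniteMeasure Q] (hreg : ZRegular Q Ψ φ θ) :
    MemLp (influence Q Ψ φ ψ θ) 2 Q :=
  (hreg.memLp_target.sub (memLp_const ψ)).sub
    (((∫ o, fderiv ℝ (φ o) θ ∂Q).comp
      (Ring.inverse (∫ o, fderiv ℝ (Ψ o) θ ∂Q))).comp_memLp' hreg.memLp_system)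

theorem integral_influence_eq_zero [CompleteSpace E] [IsProbabilityMeasure Q]
    (hreg : ZRegular Q Ψ φ θ) (hΨ0 : ∫ o, Ψ o θ ∂Q = 0) (hψ : ∫ o, φ o θ ∂Q = ψ) :
    ∫ o, influence Q Ψ φ ψ θ o ∂Q = 0 := by
  have hφi := hreg.memLp_target.integrable one_le_two
  have hΨi := hreg.memLp_system.integrable one_le_two
  let K := (∫ o, fderiv ℝ (φ o) θ ∂Q).comp (Ring.inverse (∫ o, fderiv ℝ (Ψ o) θ ∂Q))
  have hdiff : Integrable (fun o => φ o θ - ψ) Q := hφi.sub (integrable_const ψ)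
  calc ∫ o, (φ o θ - ψ - K (Ψ o θ)) ∂Q
      = ∫ o, φ o θ ∂Q - ∫ _, ψ ∂Q - K (∫ o, Ψ o θ ∂Q) := by
        rw [integral_sub hdiff (K.integrable_comp hΨi),
          integral_sub hφi (integrable_const ψ), K.integral_comp_comm hΨi]
    _ = 0 := by simp [hψ, hΨ0]

theorem exists_dominatedDeriv [MeasurableSpace E] [BorelSpace E] [SecondCountableTopology E]
    (hΨ : Measurable (Function.uncurry Ψ)) (hφ : Measurable (Function.uncurry φ))
    (hreg : ZRegular Q Ψ φ θ) :
    ∃ r G, DominatedDeriv Q Ψ θ r G ∧ DominatedDeriv Q φ θ r G := by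
  obtain ⟨r, hr, G, hG, hsmooth⟩ := hreg.smooth
  refine ⟨r, G, ⟨hr, hG, fun t => ?_, hsmooth.mono fun o ho => ho.1,
      hsmooth.mono fun o ho t ht => (ho.2.2 t ht).1⟩,
    ⟨hr, hG, fun t => ?_, hsmooth.mono fun o ho => ho.2.1,
      hsmooth.mono fun o ho t ht => (ho.2.2 t ht).2⟩⟩
  · exact (hΨ.comp measurable_prodMk_right).aestronglyMeasurable
  · exact (hφ.comp measurable_prodMk_right).aestronglyMeasurable

end ZRegular

variable [MeasurableSpace Ω'] {P' : Measure Ω'} {θhat : ℕ → Ω' → E}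

namespace IsZEstimator

variable [MeasurableSpace E] [IsProbabilityMeasure P'] [FiniteDimensional ℝ E] {r : ℝ} {G : 𝒪 → ℝ}

theorem integral_system_eq_zero (hz : IsZEstimator P' O Ψ θhat θ) (hO : IsSample P' O Q)
    (hΨ : DominatedDeriv Q Ψ θ r G) (hint : Integrable (fun o => Ψ o θ) Q) :
    ∫ o, Ψ o θ ∂Q = 0 :=
  have := FiniteDimensional.complete ℝ E
  tendsto_nhds_unique (hΨ.tendsto_sampleMean_plugIn hO hz.tendsto hint) hz.tendsto_sampleMean

theorem tendsto_sqrt_mul_sub (hz : IsZEstimator P' O Ψ θhat θ) (hO : IsSample P' O Q)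
    (hreg : ZRegular Q Ψ φ θ) (hΨ : DominatedDeriv Q Ψ θ r G) (hφ : DominatedDeriv Q φ θ r G) :
    Tendsto (fun q : ℕ × Ω' => √(q.1 : ℝ) * (plugIn O φ θhat q.1 q.2 - ψ) -
      √(q.1 : ℝ) * sampleMean O q.1 q.2 (influence Q Ψ φ ψ θ)) (highProb P' atTop) (𝓝 0) := by
  have := FiniteDimensional.complete ℝ E
  have := hO.isProbabilityMeasure
  set J := ∫ o, fderiv ℝ (Ψ o) θ ∂Q
  set L := ∫ o, fderiv ℝ (φ o) θ ∂Q
  have hinv : ∀ v, Ring.inverse J (J v) = v := fun v =>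
    DFunLike.congr_fun (Ring.inverse_mul_cancel J hreg.nonsingular) v
  have hΨ0 := hz.integral_system_eq_zero hO hΨ (hreg.memLp_system.integrable one_le_two)
  obtain ⟨C, hC, hbdd⟩ := hO.exists_eLpNorm_sqrt_smul_sampleMean_le hreg.memLp_system hΨ0
  let s : ℕ → Ω' → E := fun n ω => √(n : ℝ) • sampleMean O n ω (fun o => Ψ o θ)
  have hlin := isLittleO_sub_clm_comp hinv (hΨ.isLittleO_sampleMean_sub hO hz.tendsto)
    (hφ.isLittleO_sampleMean_sub hO hz.tendsto)
  have hscaled := (isBigO_refl (fun q : ℕ × Ω' => √(q.1 : ℝ)) _).smul_isLittleO hlin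
  have hone : (fun _ => 1 : ℕ × Ω' → ℝ) =O[highProb P' atTop] fun q => 1 + ‖s q.1 q.2‖ :=
    .of_bound 1 (.of_forall fun q => by
      rw [one_mul, norm_one]
      exact (le_add_of_nonneg_right (norm_nonneg _)).trans (le_abs_self _))
  have hs : (fun q => s q.1 q.2) =O[highProb P' atTop] fun q => 1 + ‖s q.1 q.2‖ :=
    .of_bound 1 (.of_forall fun q => by
      rw [one_mul]
      exact (le_add_of_nonneg_left zero_le_one).trans (le_abs_self _))
  have hbound := ((hz.tendsto_sqrt_smul.isBigO_one ℝ).trans hone).sub hs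
  simp only [s, ← smul_sub] at hbound
  have hrem := tendsto_zero_of_isLittleO_of_eLpNorm_le two_ne_zero ENNReal.ofNat_ne_top
    (fun n => (hO.memLp_sampleMean hreg.memLp_system n).aestronglyMeasurable.const_smul _) hC hbdd
    (hscaled.trans_isBigO hbound)
  have hroot := ((L.comp (Ring.inverse J)).continuous.tendsto 0).comp hz.tendsto_sqrt_smul
  rw [map_zero] at hroot
  refine (add_zero (0 : ℝ) ▸ hrem.add hroot).congr' ?_
  filter_upwards [tendsto_fst_highProb.eventually (eventually_ne_atTop 0)] with q hq
  rw [sampleMean_influence hq, plugIn]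
  simp only [Function.comp_apply, ContinuousLinearMap.comp_apply, map_smul, map_sub, smul_eq_mul]
  ring

end IsZEstimator

theorem isCAN_plugIn [IsProbabilityMeasure P'] [FiniteDimensional ℝ E] [MeasurableSpace E]
    [BorelSpace E] (hO : IsSample P' O Q) (hΨ : Measurable (Function.uncurry Ψ))
    (hφ : Measurable (Function.uncurry φ)) (hreg : ZRegular Q Ψ φ θ)
    (hz : IsZEstimator P' O Ψ θhat θ) (hψ : ∫ o, φ o θ ∂Q = ψ) :
    IsCAN P' (plugIn O φ θhat) ψ (asympVar Q Ψ φ ψ θ) := by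
  have := FiniteDimensional.complete ℝ E
  have := FiniteDimensional.proper_real E
  have := hO.isProbabilityMeasure
  obtain ⟨r, G, hΨd, hφd⟩ := hreg.exists_dominatedDeriv hΨ hφ
  constructor
  · refine tendstoInMeasure_const_iff.2 (hψ ▸ ?_)
    exact hφd.tendsto_sampleMean_plugIn hO hz.tendsto (hreg.memLp_target.integrable one_le_two)
  · have hΨ0 := hz.integral_system_eq_zero hO hΨd (hreg.memLp_system.integrable one_le_two)
    refine tendstoInDistribution_of_tendstoInMeasure_sub _ _
      (hO.tendstoInDistribution_sqrt_mul_sampleMean hreg.memLp_influence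
        (hreg.integral_influence_eq_zero hΨ0 hψ)) ?_ fun n => ?_
    · exact tendstoInMeasure_const_iff.2 (hz.tendsto_sqrt_mul_sub hO hreg hΨd hφd)
    · exact (((hO.measurable_sampleMean hφ (hz.measurable n) n).sub_const ψ).const_mul
        _).aemeasurable

end ZEstimation

section CondMeanZero

variable {Ω : Type*} {m m₁ m₂ mΩ : MeasurableSpace Ω} {P : Measure Ω} {D D₁ D₂ g : Ω → ℝ}

/-- `D` has conditional mean zero given `m`. Integrability is only required on the sets on which `D`
is averaged, so that the notion is stable under multiplication by every `m`-measurable function and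
applies to residuals divided by propensities that are not bounded away from zero. -/
def CondMeanZero (m : MeasurableSpace Ω) {_ : MeasurableSpace Ω} (P : Measure Ω) (D : Ω → ℝ) :
    Prop :=
  ∀ t, MeasurableSet[m] t → IntegrableOn D t P → ∫ ω in t, D ω ∂P = 0

/-- An integrable random variable with conditional mean zero given `m`, such as `f - P[f | m]`. -/
structure IsResidual (m : MeasurableSpace Ω) {_ : MeasurableSpace Ω} (P : Measure Ω) (D : Ω → ℝ) :
    Prop where
  integrable : Integrable D P
  condMeanZero : CondMeanZero m P D

namespace CondMeanZero

theorem congr (h : CondMeanZero m P D₁) (hD : D₁ =ᵐ[P] D₂) : CondMeanZero m P D₂ := by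
  intro t ht hint
  rw [← integral_congr_ae (ae_restrict_of_ae hD)]
  exact h t ht (hint.congr (ae_restrict_of_ae hD.symm))

theorem of_ae_eq_zero (h : D =ᵐ[P] 0) : CondMeanZero m P D := fun t _ _ => by
  simpa using integral_congr_ae (ae_restrict_of_ae (s := t) h)

theorem mono (h : CondMeanZero m₂ P D) (hm : m₁ ≤ m₂) : CondMeanZero m₁ P D :=
  fun t ht => h t (hm t ht)

theorem integral_eq_zero (h : CondMeanZero m P D) (hD : Integrable D P) : ∫ ω, D ω ∂P = 0 := by
  simpa using h Set.univ .univ hD.integrableOn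

theorem setIntegral_mul_eq_zero [IsFiniteMeasure P] (h : CondMeanZero m P D) (hm : m ≤ mΩ)
    (hg : StronglyMeasurable[m] g) {t : Set Ω} (ht : MeasurableSet[m] t) (hD : IntegrableOn D t P)
    (hgD : IntegrableOn (fun ω => g ω * D ω) t P) : ∫ ω in t, g ω * D ω ∂P = 0 := by
  have hzero : (P.restrict t)[D | m] =ᵐ[P.restrict t] 0 := by
    refine (ae_eq_condExp_of_forall_setIntegral_eq hm hD (fun _ _ _ => integrableOn_zero) ?_
      stronglyMeasurable_zero.aestronglyMeasurable).symm
    intro s hs _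
    rw [Measure.restrict_restrict (hm s hs), h _ (hs.inter ht) (hD.mono_set Set.inter_subset_right)]
    exact integral_zero _ _
  have hpull := condExp_mul_of_stronglyMeasurable_left hg hgD hD
  calc ∫ ω in t, g ω * D ω ∂P = ∫ ω in t, (P.restrict t)[fun ω => g ω * D ω | m] ω ∂P :=
        (integral_condExp hm).symm
    _ = ∫ ω in t, 0 ∂P := integral_congr_ae (by
        filter_upwards [hpull, hzero] with ω hω h0
        exact hω.trans (by simp [h0]))
    _ = 0 := integral_zero _ _

theorem mul [IsFiniteMeasure P] (h : CondMeanZero m P D) (hm : m ≤ mΩ)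
    (hg : Measurable[m] g) : CondMeanZero m P fun ω => g ω * D ω := by
  intro t ht hint
  let s : ℕ → Set Ω := fun k => t ∩ {ω | 1 ≤ (k : ℝ) * |g ω|}
  have hs : ∀ k, MeasurableSet[m] (s k) := fun k =>
    ht.inter ((measurable_norm.comp hg).const_mul (k : ℝ) measurableSet_Ici)
  have hmono : Monotone s := fun i j hij ω hω =>
    ⟨hω.1, le_trans (b := (i : ℝ) * |g ω|) hω.2 (by gcongr)⟩
  have hst : ⋃ k, s k ⊆ t := Set.iUnion_subset fun _ => Set.inter_subset_left
  have hsupport : ∀ ω ∈ t \ ⋃ k, s k, g ω * D ω = 0 := fun ω hω => by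
    have hg0 : g ω = 0 := by
      by_contra hne
      obtain ⟨k, hk⟩ := exists_nat_ge (|g ω|⁻¹)
      exact hω.2 (Set.mem_iUnion.2 ⟨k, hω.1, (inv_le_iff_one_le_mul₀ (abs_pos.2 hne)).1 hk⟩)
    rw [hg0, zero_mul]
  have hD : ∀ k, IntegrableOn D (s k) P := fun k => by
    have hbdd : ∀ ω ∈ s k, ‖(g ω)⁻¹‖ ≤ k ∧ g ω ≠ 0 := fun ω hω => by
      have hg0 : g ω ≠ 0 := fun h0 => by simpa [s, h0, not_le.2] using hω.2
      exact ⟨(norm_inv (g ω)).trans_le ((inv_le_iff_one_le_mul₀ (abs_pos.2 hg0)).2 hω.2), hg0⟩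
    refine ((hint.mono_set Set.inter_subset_left).bdd_mul
      (hg.mono hm le_rfl).inv.aestronglyMeasurable
      ((ae_restrict_iff' (hm _ (hs k))).2 (.of_forall fun ω hω => (hbdd ω hω).1))).congr ?_
    refine (ae_restrict_iff' (hm _ (hs k))).2 (.of_forall fun ω hω => ?_)
    exact inv_mul_cancel_left₀ (hbdd ω hω).2 _
  have hlim := tendsto_setIntegral_of_monotone (fun k => hm _ (hs k)) hmono (hint.mono_set hst)
  refine (setIntegral_eq_of_subset_of_forall_sdiff_eq_zero (hm _ ht) hst hsupport).trans ?_
  refine tendsto_nhds_unique hlim (tendsto_const_nhds.congr fun k => ?_)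
  exact (h.setIntegral_mul_eq_zero hm hg.stronglyMeasurable (hs k) (hD k)
    (hint.mono_set Set.inter_subset_left)).symm

theorem ae_eq_zero [IsFiniteMeasure P] (h : CondMeanZero m P D) (hm : m ≤ mΩ)
    (hD : Measurable[m] D) : D =ᵐ[P] 0 := by
  have hq : Measurable[m] fun ω => (1 + D ω ^ 2)⁻¹ * D ω :=
    (measurable_const.add (hD.pow_const 2)).inv.mul hD
  have hbdd : ∀ ω, ‖(1 + D ω ^ 2)⁻¹ * D ω * D ω‖ ≤ 1 := fun ω => by
    rw [mul_assoc, ← sq, Real.norm_of_nonneg (by positivity), inv_mul_le_one₀ (by positivity)]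
    exact le_add_of_nonneg_left zero_le_one
  have hint : Integrable (fun ω => (1 + D ω ^ 2)⁻¹ * D ω * D ω) P :=
    .of_bound ((hq.mul hD).mono hm le_rfl).aestronglyMeasurable 1 (.of_forall hbdd)
  have hnonneg : ∀ ω, 0 ≤ (1 + D ω ^ 2)⁻¹ * D ω * D ω := fun ω => by
    rw [mul_assoc, ← sq]
    positivity
  filter_upwards [(integral_eq_zero_iff_of_nonneg hnonneg hint).1
    ((h.mul hm hq).integral_eq_zero hint)] with ω hω
  have : 1 + D ω ^ 2 ≠ 0 := by positivity
  simpa [this] using hω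

end CondMeanZero

namespace IsResidual

theorem of_condExp [IsFiniteMeasure P] (hm : m ≤ mΩ) {f : Ω → ℝ} (hf : Integrable f P)
    (h : P[f | m] =ᵐ[P] g) : IsResidual m P fun ω => f ω - g ω := by
  have hg : Integrable g P := integrable_condExp.congr h
  refine ⟨hf.sub hg, fun t ht _ => ?_⟩
  rw [integral_sub hf.integrableOn hg.integrableOn, ← setIntegral_condExp hm hf ht,
    setIntegral_congr_ae (hm t ht) (h.mono fun _ hω _ => hω), sub_self]

theorem add_condMeanZero (h₁ : IsResidual m₁ P D₁) (h₂ : CondMeanZero m₂ P D₂) (hm : m₁ ≤ m₂) :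
    CondMeanZero m₁ P fun ω => D₁ ω + D₂ ω := by
  intro t ht hint
  have hD₁ : IntegrableOn D₁ t P := h₁.integrable.integrableOn
  have hD₂ : IntegrableOn D₂ t P :=
    (hint.sub hD₁).congr (.of_forall fun ω => add_sub_cancel_left _ _)
  rw [integral_add hD₁ hD₂, h₁.condMeanZero t ht hD₁, h₂ t (hm t ht) hD₂, add_zero]

/-- Divide by `1 + |g|`, which makes the first term integrable, add, and multiply back. -/
theorem mul_add_condMeanZero [IsFiniteMeasure P] (h₁ : IsResidual m₁ P D₁)
    (h₂ : CondMeanZero m₂ P D₂) (hm : m₁ ≤ m₂) (hm₂ : m₂ ≤ mΩ) (hg : Measurable[m₁] g) :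
    CondMeanZero m₁ P fun ω => g ω * D₁ ω + D₂ ω := by
  have hm₁ := hm.trans hm₂
  have hH : Measurable[m₁] fun ω => 1 + |g ω| := measurable_const.add (measurable_norm.comp hg)
  have hq : Measurable[m₁] fun ω => (1 + |g ω|)⁻¹ * g ω := hH.inv.mul hg
  have hpos : ∀ ω, 0 < 1 + |g ω| := fun ω => by positivity
  have hbdd : ∀ ω, ‖(1 + |g ω|)⁻¹ * g ω‖ ≤ 1 := fun ω => by
    rw [norm_mul, norm_inv, Real.norm_of_nonneg (hpos ω).le, Real.norm_eq_abs,
      inv_mul_le_one₀ (hpos ω)]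
    exact le_add_of_nonneg_left zero_le_one
  have hscaled : IsResidual m₁ P fun ω => (1 + |g ω|)⁻¹ * g ω * D₁ ω :=
    ⟨h₁.integrable.bdd_mul (hq.mono hm₁ le_rfl).aestronglyMeasurable (.of_forall hbdd),
      h₁.condMeanZero.mul hm₁ hq⟩
  have hsum := (hscaled.add_condMeanZero (h₂.mul hm₂ (hH.inv.mono hm le_rfl)) hm).mul hm₁ hH
  refine hsum.congr (.of_forall fun ω => ?_)
  have := (hpos ω).ne'
  simp only [Pi.inv_apply]
  field_simp

theorem sum_mul [IsFiniteMeasure P] {ι : Type*} {D g : ι → Ω → ℝ} (s : Finset ι)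
    (h : ∀ i, IsResidual m P (D i)) (hm : m ≤ mΩ) (hg : ∀ i, Measurable[m] (g i)) :
    CondMeanZero m P fun ω => ∑ i ∈ s, g i ω * D i ω := by
  classical
  induction s using Finset.induction_on with
  | empty => exact .of_ae_eq_zero (.of_forall fun _ => Finset.sum_empty)
  | insert i s hi ih =>
    simp only [Finset.sum_insert hi]
    exact (h i).mul_add_condMeanZero ih le_rfl hm (hg i)

/-- Multiplying the residual `b - p` by `-f` and adding `b * f` leaves `p * f`. -/
theorem ae_eq_zero_of_condMean_pos [IsFiniteMeasure P] {b p f : Ω → ℝ}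
    (hres : IsResidual m P fun ω => b ω - p ω) (hf : CondMeanZero m P fun ω => b ω * f ω)
    (hm : m ≤ mΩ) (hp : Measurable[m] p) (hpos : ∀ᵐ ω ∂P, 0 < p ω) (hfm : Measurable[m] f) :
    f =ᵐ[P] 0 := by
  have hpf : CondMeanZero m P fun ω => p ω * f ω :=
    (hres.mul_add_condMeanZero hf le_rfl hm hfm.neg).congr (.of_forall fun ω => by
      simp only [Pi.neg_apply]
      ring)
  filter_upwards [hpf.ae_eq_zero hm (hp.mul hfm), hpos] with ω hω hpω
  exact (mul_eq_zero.1 hω).resolve_left hpω.ne'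

end IsResidual

end CondMeanZero

section CondDistrib

variable {Ω 𝒰 𝒲 : Type*} [MeasurableSpace Ω] [MeasurableSpace 𝒰] [MeasurableSpace 𝒲]
  {P : Measure Ω} [IsFiniteMeasure P] {U : Ω → 𝒰} {W : Ω → 𝒲} {Y : Ω → ℝ}

namespace IsResidual

theorem sub_integral_condDistrib (hU : Measurable U) (hY : Integrable Y P) :
    IsResidual (MeasurableSpace.comap U inferInstance) P
      fun ω => Y ω - ∫ y, y ∂condDistrib Y U P (U ω) :=
  of_condExp hU.comap_le hY (condExp_ae_eq_integral_condDistrib' hU hY)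

theorem comp_sub_integral_condDistrib [StandardBorelSpace 𝒲] [Nonempty 𝒲] (hU : Measurable U)
    (hW : Measurable W) {f : 𝒰 × 𝒲 → ℝ} (hf : Measurable f)
    (hint : Integrable (fun ω => f (U ω, W ω)) P) :
    IsResidual (MeasurableSpace.comap U inferInstance) P
      fun ω => f (U ω, W ω) - ∫ w, f (U ω, w) ∂condDistrib W U P (U ω) :=
  of_condExp hU.comap_le hint
    (condExp_prod_ae_eq_integral_condDistrib hU hW.aemeasurable hf.stronglyMeasurable hint)

theorem ite_sub_condDistrib_real [StandardBorelSpace 𝒲] [Nonempty 𝒲] [DecidableEq 𝒲]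
    [MeasurableSingletonClass 𝒲] (hU : Measurable U) (hW : Measurable W) (w : 𝒲) :
    IsResidual (MeasurableSpace.comap U inferInstance) P
      fun ω => (if W ω = w then (1 : ℝ) else 0) - (condDistrib W U P (U ω)).real {w} := by
  have hs : MeasurableSet ({w} : Set 𝒲) := measurableSet_singleton w
  have hind : (fun ω => if W ω = w then (1 : ℝ) else 0) =
      (W ⁻¹' {w}).indicator fun _ => (1 : ℝ) := by
    ext ω
    simp [Set.indicator]
  refine of_condExp hU.comap_le ?_ ?_ <;> rw [hind]
  · exact (integrable_const _).indicator (hW hs)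
  · exact (condDistrib_ae_eq_condExp hU hW hs).symm

theorem sub_integral_condDistrib_of_condIndepFun [StandardBorelSpace Ω] [StandardBorelSpace 𝒲]
    [Nonempty 𝒲] (hU : Measurable U) (hW : Measurable W) (hY : Measurable Y)
    (hint : Integrable Y P)
    (hind : CondIndepFun (MeasurableSpace.comap U inferInstance) hU.comap_le Y W P) :
    IsResidual (MeasurableSpace.comap (fun ω => (U ω, W ω)) inferInstance) P
      fun ω => Y ω - ∫ y, y ∂condDistrib Y U P (U ω) := by
  have hUW : Measurable fun ω => (U ω, W ω) := hU.prodMk hW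
  have hkernel := (condIndepFun_iff_condDistrib_prod_ae_eq_prodMkRight hY hW hU).1 hind.symm
  refine of_condExp hUW.comap_le hint ?_
  filter_upwards [condExp_ae_eq_integral_condDistrib' hUW hint,
    ae_of_ae_map hUW.aemeasurable hkernel] with ω hω hk
  rw [hω, hk, Kernel.prodMkRight_apply]

end IsResidual

theorem measurable_integral_condDistrib {f : 𝒰 × 𝒲 → ℝ} [StandardBorelSpace 𝒲] [Nonempty 𝒲]
    (hf : Measurable f) : Measurable fun u => ∫ w, f (u, w) ∂condDistrib W U P u :=
  (hf.stronglyMeasurable.integral_condDistrib).measurable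

end CondDistrib

/-- The source of double robustness: the error of the augmented value is a combination of the
residual `b - π` and the residual `y - y'`, whether the model `μ` of the regression `κ` or the model
`p` of the propensity `π` is the true one. -/
theorem augmented_sub_eq {b y y' μ κ p π : ℝ} (hπ : π ≠ 0) (hy : b * y' = b * κ)
    (h : μ = κ ∨ p = π) :
    μ + b / p * (y - μ) - κ = (κ - μ) / π * (b - π) + b / p * (y - y') := by
  have hy' : b / p * y' = b / p * κ := by rw [div_mul_eq_mul_div, hy, div_mul_eq_mul_div]
  rw [mul_sub (b / p) y y', hy']
  rcases h with rfl | rfl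
  · ring
  · field_simp
    ring

namespace Population

section Information

variable {Ω 𝒳 𝒜 𝒵 ℳ : Type*} [mΩ : MeasurableSpace Ω] [MeasurableSpace 𝒳] [MeasurableSpace 𝒜]
  [MeasurableSpace 𝒵] [MeasurableSpace ℳ] {P : Measure Ω} (V : Population Ω 𝒳 𝒜 𝒵 ℳ P)

theorem measurable_XA : Measurable V.XA :=
  V.measurable_X.prodMk V.measurable_A

theorem measurable_XAZM : Measurable V.XAZM :=
  V.measurable_X.prodMk (V.measurable_A.prodMk (V.measurable_Z.prodMk V.measurable_M))

theorem measurable_obs : Measurable V.obs :=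
  V.measurable_X.prodMk (V.measurable_A.prodMk (V.measurable_Z.prodMk
    (V.measurable_M.prodMk V.measurable_Y)))

/-- The information in `X`. -/
abbrev sigmaX : MeasurableSpace Ω := MeasurableSpace.comap V.X inferInstance

/-- The information in `(X, A)`. -/
abbrev sigmaXA : MeasurableSpace Ω := MeasurableSpace.comap V.XA inferInstance

/-- The information in `(X, A, Z)`. -/
abbrev sigmaXAZ : MeasurableSpace Ω := MeasurableSpace.comap V.XAZ inferInstance

/-- The information in `(X, A, Z, M)`. -/
abbrev sigmaXAZM : MeasurableSpace Ω := MeasurableSpace.comap V.XAZM inferInstance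

theorem sigmaX_le : V.sigmaX ≤ mΩ := V.measurable_X.comap_le

theorem sigmaXA_le : V.sigmaXA ≤ mΩ := V.measurable_XA.comap_le

theorem sigmaXAZ_le : V.sigmaXAZ ≤ mΩ := V.measurable_XAZ.comap_le

theorem sigmaXAZM_le : V.sigmaXAZM ≤ mΩ := V.measurable_XAZM.comap_le

theorem sigmaX_le_sigmaXA : V.sigmaX ≤ V.sigmaXA :=
  (comap_measurable V.XA).fst.comap_le

theorem sigmaXA_le_sigmaXAZ : V.sigmaXA ≤ V.sigmaXAZ :=
  have h := comap_measurable V.XAZ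
  (h.fst.prodMk h.snd.fst).comap_le

theorem sigmaXAZ_le_sigmaXAZM : V.sigmaXAZ ≤ V.sigmaXAZM :=
  have h := comap_measurable V.XAZM
  (h.fst.prodMk (h.snd.fst.prodMk h.snd.snd.fst)).comap_le

theorem sigmaXAZM_le_comap_prodMk :
    V.sigmaXAZM ≤ MeasurableSpace.comap (fun ω => (V.XAZ ω, V.M ω)) inferInstance :=
  have h := comap_measurable fun ω => (V.XAZ ω, V.M ω)
  (h.fst.fst.prodMk (h.fst.snd.fst.prodMk (h.fst.snd.snd.prodMk h.snd))).comap_le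

end Information

section TrueFunctions

variable {Ω 𝒳 𝒜 𝒵 ℳ : Type*} [MeasurableSpace Ω] [MeasurableSpace 𝒳] [MeasurableSpace 𝒜]
  [MeasurableSpace 𝒵] [MeasurableSpace ℳ] {P : Measure Ω} [IsFiniteMeasure P]
  (V : Population Ω 𝒳 𝒜 𝒵 ℳ P)

/-- `E[Y | x, a', z, M = m]`, as a function of `(x, a', z)`: the function averaged over `z` in
`nuY`. -/
noncomputable def muYAt (m : ℳ) (v : 𝒳 × 𝒜 × 𝒵) : ℝ := V.muY (v.1, v.2.1, v.2.2, m)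

/-- `E[Y(a, m) | x, a', z]`. -/
noncomputable def potXAZ (a : 𝒜) (m : ℳ) (v : 𝒳 × 𝒜 × 𝒵) : ℝ :=
  ∫ y, y ∂condDistrib (V.Ypot a m) V.XAZ P v

/-- `E[Y(a, m) | x]`. -/
noncomputable def potX (a : 𝒜) (m : ℳ) (x : 𝒳) : ℝ :=
  ∫ y, y ∂condDistrib (V.Ypot a m) V.X P x

theorem measurable_muY : Measurable V.muY :=
  measurable_integral_condDistrib measurable_snd

theorem measurable_muYAt (m : ℳ) : Measurable (V.muYAt m) :=
  V.measurable_muY.comp (by fun_prop)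

theorem measurable_nuY [StandardBorelSpace 𝒵] [Nonempty 𝒵] (m : ℳ) : Measurable (V.nuY m) :=
  measurable_integral_condDistrib (f := fun q : (𝒳 × 𝒜) × 𝒵 => V.muY (q.1.1, q.1.2, q.2, m))
    (V.measurable_muY.comp (by fun_prop))

theorem measurable_potXAZ (a : 𝒜) (m : ℳ) : Measurable (V.potXAZ a m) :=
  measurable_integral_condDistrib measurable_snd

theorem measurable_potX (a : 𝒜) (m : ℳ) : Measurable (V.potX a m) :=
  measurable_integral_condDistrib measurable_snd

theorem measurable_piA [StandardBorelSpace 𝒜] [Nonempty 𝒜] (l : 𝒜) :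
    Measurable fun x => V.piA x l :=
  (Kernel.measurable_coe _ (measurableSet_singleton l)).ennreal_toReal

theorem measurable_piM [StandardBorelSpace ℳ] [Nonempty ℳ] (l : ℳ) :
    Measurable fun v => V.piM v l :=
  (Kernel.measurable_coe _ (measurableSet_singleton l)).ennreal_toReal

variable {V}

theorem ae_piA_pos [StandardBorelSpace 𝒜] [Nonempty 𝒜] [StandardBorelSpace ℳ] [Nonempty ℳ]
    (hpos : V.Positivity) (l : 𝒜) : ∀ᵐ ω ∂P, 0 < V.piA (V.X ω) l := by
  obtain ⟨ε, hε, h, -⟩ := hpos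
  filter_upwards [ae_of_ae_map V.measurable_X.aemeasurable (h l)] with ω hω using hε.trans hω

theorem ae_piM_pos [StandardBorelSpace 𝒜] [Nonempty 𝒜] [StandardBorelSpace ℳ] [Nonempty ℳ]
    (hpos : V.Positivity) (l : ℳ) : ∀ᵐ ω ∂P, 0 < V.piM (V.XAZ ω) l := by
  obtain ⟨ε, hε, -, h⟩ := hpos
  filter_upwards [ae_of_ae_map V.measurable_XAZ.aemeasurable (h l)] with ω hω using hε.trans hω

end TrueFunctions

section Residuals

variable {Ω 𝒳 𝒜 𝒵 ℳ : Type*} [MeasurableSpace Ω] [MeasurableSpace 𝒳] [MeasurableSpace 𝒜]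
  [MeasurableSpace 𝒵] [MeasurableSpace ℳ] {P : Measure Ω} {V : Population Ω 𝒳 𝒜 𝒵 ℳ P}

theorem integrable_Y [Finite 𝒜] [Finite ℳ] (hcons : V.Consistency) : Integrable V.Y P := by
  have := Fintype.ofFinite 𝒜
  have := Fintype.ofFinite ℳ
  have hbound : Integrable (fun ω => ∑ a, ∑ m, |V.Ypot a m ω|) P :=
    integrable_finsetSum _ fun a _ => integrable_finsetSum _ fun m _ => (V.integrable_Ypot a m).abs
  refine hbound.mono' V.measurable_Y.aestronglyMeasurable ?_
  have hall : ∀ᵐ ω ∂P, ∀ a m, V.A ω = a → V.M ω = m → V.Y ω = V.Ypot a m ω :=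
    ae_all_iff.2 fun a => ae_all_iff.2 fun m => hcons a m
  filter_upwards [hall] with ω hω
  rw [hω _ _ rfl rfl, Real.norm_eq_abs]
  calc |V.Ypot (V.A ω) (V.M ω) ω| ≤ ∑ m, |V.Ypot (V.A ω) m ω| :=
        Finset.single_le_sum (f := fun m => |V.Ypot (V.A ω) m ω|)
          (fun _ _ => abs_nonneg _) (Finset.mem_univ _)
    _ ≤ ∑ a, ∑ m, |V.Ypot a m ω| :=
        Finset.single_le_sum (f := fun a => ∑ m, |V.Ypot a m ω|)
          (fun _ _ => Finset.sum_nonneg fun _ _ => abs_nonneg _) (Finset.mem_univ _)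

variable [IsFiniteMeasure P]

variable (V) in
theorem isResidual_A [StandardBorelSpace 𝒜] [Nonempty 𝒜] [DecidableEq 𝒜] (l : 𝒜) :
    IsResidual V.sigmaX P fun ω => (if V.A ω = l then (1 : ℝ) else 0) - V.piA (V.X ω) l :=
  .ite_sub_condDistrib_real V.measurable_X V.measurable_A l

variable (V) in
theorem isResidual_M [StandardBorelSpace ℳ] [Nonempty ℳ] [DecidableEq ℳ] (l : ℳ) :
    IsResidual V.sigmaXAZ P fun ω => (if V.M ω = l then (1 : ℝ) else 0) - V.piM (V.XAZ ω) l :=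
  .ite_sub_condDistrib_real V.measurable_XAZ V.measurable_M l

theorem isResidual_Y [Finite 𝒜] [Finite ℳ] (hcons : V.Consistency) :
    IsResidual V.sigmaXAZM P fun ω => V.Y ω - V.muY (V.XAZM ω) :=
  .sub_integral_condDistrib V.measurable_XAZM (integrable_Y hcons)

variable (V) in
theorem integrable_potXAZ (a : 𝒜) (m : ℳ) : Integrable (fun ω => V.potXAZ a m (V.XAZ ω)) P :=
  ((V.integrable_Ypot a m).sub
    (IsResidual.sub_integral_condDistrib V.measurable_XAZ (V.integrable_Ypot a m)).integrable).congr
    (.of_forall fun _ => sub_sub_cancel _ _)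

variable (V) in
theorem integrable_potX (a : 𝒜) (m : ℳ) : Integrable (fun ω => V.potX a m (V.X ω)) P :=
  ((V.integrable_Ypot a m).sub
    (IsResidual.sub_integral_condDistrib V.measurable_X (V.integrable_Ypot a m)).integrable).congr
    (.of_forall fun _ => sub_sub_cancel _ _)

variable [StandardBorelSpace Ω]

theorem isResidual_Ypot_sub_potX [StandardBorelSpace 𝒜] [Nonempty 𝒜]
    (hign : V.SequentialIgnorability) (a : 𝒜) (m : ℳ) :
    IsResidual V.sigmaXA P fun ω => V.Ypot a m ω - V.potX a m (V.X ω) :=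
  .sub_integral_condDistrib_of_condIndepFun V.measurable_X V.measurable_A (V.measurable_Ypot a m)
    (V.integrable_Ypot a m) (hign.1 a m)

theorem isResidual_Ypot_sub_potXAZ [StandardBorelSpace ℳ] [Nonempty ℳ]
    (hign : V.SequentialIgnorability) (a : 𝒜) (m : ℳ) :
    IsResidual V.sigmaXAZM P fun ω => V.Ypot a m ω - V.potXAZ a m (V.XAZ ω) :=
  have h := IsResidual.sub_integral_condDistrib_of_condIndepFun V.measurable_XAZ V.measurable_M
    (V.measurable_Ypot a m) (V.integrable_Ypot a m) (hign.2 a m)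
  ⟨h.integrable, h.condMeanZero.mono V.sigmaXAZM_le_comap_prodMk⟩

end Residuals

section Identification

variable {Ω 𝒳 𝒜 𝒵 ℳ : Type*} [MeasurableSpace Ω] [StandardBorelSpace Ω] [MeasurableSpace 𝒳]
  [Finite 𝒜] [Nonempty 𝒜] [MeasurableSpace 𝒜] [DiscreteMeasurableSpace 𝒜] [MeasurableSpace 𝒵]
  [Finite ℳ] [Nonempty ℳ] [MeasurableSpace ℳ] [DiscreteMeasurableSpace ℳ]
  {P : Measure Ω} [IsFiniteMeasure P] {V : Population Ω 𝒳 𝒜 𝒵 ℳ P}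

/-- On the cell `A = a`, `M = m` both functions are conditional means of the same variable, and
positivity transfers this to all of `A = a`. -/
theorem ae_muYAt_eq_potXAZ (hcons : V.Consistency) (hign : V.SequentialIgnorability)
    (hpos : V.Positivity) (a : 𝒜) (m : ℳ) :
    ∀ᵐ ω ∂P, V.A ω = a → V.muYAt m (V.XAZ ω) = V.potXAZ a m (V.XAZ ω) := by
  classical
  let cell : 𝒳 × 𝒜 × 𝒵 × ℳ → ℝ := fun v => if v.2.1 = a ∧ v.2.2.2 = m then 1 else 0
  have hcell : Measurable[V.sigmaXAZM] fun ω => cell (V.XAZM ω) :=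
    Measurable.comp (g := cell) (Measurable.ite (by measurability) measurable_const
      measurable_const) (comap_measurable V.XAZM)
  let diff : 𝒳 × 𝒜 × 𝒵 → ℝ := fun v => if v.2.1 = a then V.muYAt m v - V.potXAZ a m v else 0
  have hdiff : Measurable diff := Measurable.ite (by measurability)
    ((V.measurable_muYAt m).sub (V.measurable_potXAZ a m)) measurable_const
  have hmean : CondMeanZero V.sigmaXAZ P
      fun ω => (if V.M ω = m then (1 : ℝ) else 0) * diff (V.XAZ ω) := by
    refine (((isResidual_Ypot_sub_potXAZ hign a m).mul_add_condMeanZero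
      ((isResidual_Y hcons).condMeanZero.mul V.sigmaXAZM_le hcell.neg) le_rfl V.sigmaXAZM_le
      hcell).mono V.sigmaXAZ_le_sigmaXAZM).congr ?_
    filter_upwards [hcons a m] with ω hω
    by_cases hA : V.A ω = a <;> by_cases hM : V.M ω = m <;>
      simp [cell, diff, XAZ, XAZM, muYAt, hA, hM]
    simp [hω hA hM]
  filter_upwards [(V.isResidual_M m).ae_eq_zero_of_condMean_pos hmean V.sigmaXAZ_le
    ((V.measurable_piM m).comp (comap_measurable V.XAZ)) (ae_piM_pos hpos m)
    (hdiff.comp (comap_measurable V.XAZ))] with ω hω hA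
  exact sub_eq_zero.1 ((if_pos hA).symm.trans hω)

theorem integrable_muYAt (hcons : V.Consistency) (hign : V.SequentialIgnorability)
    (hpos : V.Positivity) (m : ℳ) : Integrable (fun ω => V.muYAt m (V.XAZ ω)) P := by
  have := Fintype.ofFinite 𝒜
  refine (integrable_finsetSum Finset.univ fun a _ => (V.integrable_potXAZ a m).abs).mono'
    ((V.measurable_muYAt m).comp V.measurable_XAZ).aestronglyMeasurable ?_
  filter_upwards [ae_all_iff.2 fun a => ae_muYAt_eq_potXAZ hcons hign hpos a m] with ω hω
  rw [hω _ rfl]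
  exact Finset.single_le_sum (f := fun a => |V.potXAZ a m (V.XAZ ω)|)
    (fun _ _ => abs_nonneg _) (Finset.mem_univ _)

variable [StandardBorelSpace 𝒵] [Nonempty 𝒵]

theorem isResidual_muYAt (hcons : V.Consistency) (hign : V.SequentialIgnorability)
    (hpos : V.Positivity) (m : ℳ) :
    IsResidual V.sigmaXA P fun ω => V.muYAt m (V.XAZ ω) - V.nuY m (V.XA ω) :=
  .comp_sub_integral_condDistrib (f := fun q : (𝒳 × 𝒜) × 𝒵 => V.muY (q.1.1, q.1.2, q.2, m))
    V.measurable_XA V.measurable_Z (V.measurable_muY.comp (by fun_prop))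
    (integrable_muYAt hcons hign hpos m)

theorem ae_nuY_eq_potX (hcons : V.Consistency) (hign : V.SequentialIgnorability)
    (hpos : V.Positivity) (a : 𝒜) (m : ℳ) :
    ∀ᵐ ω ∂P, V.nuY m (V.X ω, a) = V.potX a m (V.X ω) := by
  classical
  let b : 𝒜 → ℝ := fun a' => if a' = a then 1 else 0
  have hb : Measurable[V.sigmaXA] fun ω => b (V.A ω) :=
    (Measurable.of_discrete (f := b)).comp (comap_measurable V.XA).snd
  have hmean : CondMeanZero V.sigmaX P fun ω =>
      b (V.A ω) * (V.nuY m (V.X ω, a) - V.potX a m (V.X ω)) := by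
    have hpot : CondMeanZero V.sigmaXA P fun ω =>
        -b (V.A ω) * (V.Ypot a m ω - V.potXAZ a m (V.XAZ ω)) :=
      ((isResidual_Ypot_sub_potXAZ hign a m).condMeanZero.mono
        (V.sigmaXA_le_sigmaXAZ.trans V.sigmaXAZ_le_sigmaXAZM)).mul V.sigmaXA_le hb.neg
    have hsum := (isResidual_Ypot_sub_potX hign a m).mul_add_condMeanZero
      ((isResidual_muYAt hcons hign hpos m).mul_add_condMeanZero hpot le_rfl V.sigmaXA_le hb.neg)
      le_rfl V.sigmaXA_le hb
    refine (hsum.mono V.sigmaX_le_sigmaXA).congr ?_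
    filter_upwards [ae_muYAt_eq_potXAZ hcons hign hpos a m] with ω hω
    by_cases hA : V.A ω = a
    · simp [b, XA, hA, hω hA]
    · simp [b, hA]
  filter_upwards [(V.isResidual_A a).ae_eq_zero_of_condMean_pos hmean V.sigmaX_le
    ((V.measurable_piA a).comp (comap_measurable V.X)) (ae_piA_pos hpos a)
    ((((V.measurable_nuY m).comp (by fun_prop : Measurable fun x => (x, a))).sub
      (V.measurable_potX a m)).comp (comap_measurable V.X))] with ω hω using sub_eq_zero.1 hω

theorem integrable_nuY (hcons : V.Consistency) (hign : V.SequentialIgnorability)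
    (hpos : V.Positivity) (a : 𝒜) (m : ℳ) : Integrable (fun ω => V.nuY m (V.X ω, a)) P :=
  (V.integrable_potX a m).congr ((ae_nuY_eq_potX hcons hign hpos a m).mono fun _ => Eq.symm)

theorem integral_nuY (hcons : V.Consistency) (hign : V.SequentialIgnorability)
    (hpos : V.Positivity) (a : 𝒜) (m : ℳ) : ∫ ω, V.nuY m (V.X ω, a) ∂P = V.psi a m := by
  have hres := isResidual_Ypot_sub_potX hign a m
  have hzero := hres.condMeanZero.integral_eq_zero hres.integrable
  rw [integral_sub (V.integrable_Ypot a m) (V.integrable_potX a m), sub_eq_zero] at hzero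
  exact (integral_congr_ae (ae_nuY_eq_potX hcons hign hpos a m)).trans hzero.symm

end Identification

section Augmentation

variable {Ω 𝒳 𝒜 𝒵 ℳ : Type*} [MeasurableSpace Ω] [StandardBorelSpace Ω] [MeasurableSpace 𝒳]
  [Finite 𝒜] [DecidableEq 𝒜] [Nonempty 𝒜] [MeasurableSpace 𝒜] [DiscreteMeasurableSpace 𝒜]
  [MeasurableSpace 𝒵] [StandardBorelSpace 𝒵] [Nonempty 𝒵]
  [Finite ℳ] [Nonempty ℳ] [MeasurableSpace ℳ] [DiscreteMeasurableSpace ℳ]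
  {P : Measure Ω} [IsFiniteMeasure P] {V : Population Ω 𝒳 𝒜 𝒵 ℳ P}

theorem condMeanZero_augmentedResponse [DecidableEq ℳ] (hcons : V.Consistency)
    (hign : V.SequentialIgnorability) (hpos : V.Positivity) (m : ℳ) (S : Finset 𝒜)
    {μ p : 𝒳 × 𝒜 × 𝒵 → ℝ} (hμ : Measurable μ) (hp : Measurable p)
    (hcorrect : ∀ᵐ ω ∂P, V.A ω ∈ S →
      μ (V.XAZ ω) = V.muYAt m (V.XAZ ω) ∨ p (V.XAZ ω) = V.piM (V.XAZ ω) m) :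
    CondMeanZero V.sigmaXA P fun ω => (if V.A ω ∈ S then (1 : ℝ) else 0) *
      (μ (V.XAZ ω) + (if V.M ω = m then (1 : ℝ) else 0) / p (V.XAZ ω) * (V.Y ω - μ (V.XAZ ω)) -
        V.nuY m (V.XA ω)) := by
  let c : 𝒜 → ℝ := fun a' => if a' ∈ S then 1 else 0
  let b : ℳ → ℝ := fun m' => if m' = m then 1 else 0
  have hc : Measurable c := .of_discrete
  have hb : Measurable b := .of_discrete
  let gM : 𝒳 × 𝒜 × 𝒵 → ℝ := fun v => c v.2.1 * ((V.muYAt m v - μ v) / V.piM v m)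
  have hgM : Measurable gM := (hc.comp measurable_snd.fst).mul
    (((V.measurable_muYAt m).sub hμ).div (V.measurable_piM m))
  let gY : 𝒳 × 𝒜 × 𝒵 × ℳ → ℝ := fun v => c v.2.1 * (b v.2.2.2 / p (v.1, v.2.1, v.2.2.1))
  have hgY : Measurable gY := (hc.comp measurable_snd.fst).mul
    ((hb.comp measurable_snd.snd.snd).div (hp.comp (by fun_prop)))
  have hYM : CondMeanZero V.sigmaXAZ P fun ω => gM (V.XAZ ω) * (b (V.M ω) - V.piM (V.XAZ ω) m) +
      gY (V.XAZM ω) * (V.Y ω - V.muY (V.XAZM ω)) :=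
    (V.isResidual_M m).mul_add_condMeanZero ((isResidual_Y hcons).condMeanZero.mul V.sigmaXAZM_le
      (hgY.comp (comap_measurable V.XAZM))) V.sigmaXAZ_le_sigmaXAZM V.sigmaXAZM_le
      (hgM.comp (comap_measurable V.XAZ))
  refine ((isResidual_muYAt hcons hign hpos m).mul_add_condMeanZero hYM V.sigmaXA_le_sigmaXAZ
    V.sigmaXAZ_le (hc.comp (comap_measurable V.XA).snd)).congr ?_
  filter_upwards [hcorrect, ae_piM_pos hpos m] with ω hω hπ
  change c (V.A ω) * (V.muYAt m (V.XAZ ω) - V.nuY m (V.XA ω)) +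
      (gM (V.XAZ ω) * (b (V.M ω) - V.piM (V.XAZ ω) m) +
        gY (V.XAZM ω) * (V.Y ω - V.muY (V.XAZM ω))) =
    c (V.A ω) * (μ (V.XAZ ω) + b (V.M ω) / p (V.XAZ ω) * (V.Y ω - μ (V.XAZ ω)) - V.nuY m (V.XA ω))
  by_cases hA : V.A ω ∈ S
  · have hcell : b (V.M ω) * V.muY (V.XAZM ω) = b (V.M ω) * V.muYAt m (V.XAZ ω) := by
      by_cases hM : V.M ω = m <;> simp [b, XAZ, XAZM, muYAt, hM]
    have herror := augmented_sub_eq (y := V.Y ω) hπ.ne' hcell (hω hA)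
    simp only [c, gM, gY, XAZ, XAZM, hA, if_true] at herror ⊢
    linear_combination -herror
  · simp [c, gM, gY, XAZ, XAZM, hA]

theorem integral_augmented (hcons : V.Consistency) (hign : V.SequentialIgnorability)
    (hpos : V.Positivity) {a : 𝒜} {m : ℳ} {S : Finset 𝒜} (ha : a ∈ S) {N p : 𝒳 → ℝ}
    (hN : Measurable N) (hp : Measurable p) {R : Ω → ℝ}
    (hR : CondMeanZero V.sigmaXA P fun ω =>
      (if V.A ω ∈ S then (1 : ℝ) else 0) * (R ω - V.nuY m (V.XA ω)))
    (hcorrect : ∀ᵐ ω ∂P, N (V.X ω) = V.nuY m (V.X ω, a) ∨ p (V.X ω) = V.piA (V.X ω) a)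
    (hint : Integrable (fun ω => N (V.X ω) + (if V.A ω = a then (1 : ℝ) else 0) / p (V.X ω) *
      (R ω - N (V.X ω))) P) :
    ∫ ω, N (V.X ω) + (if V.A ω = a then (1 : ℝ) else 0) / p (V.X ω) *
      (R ω - N (V.X ω)) ∂P = V.psi a m := by
  let b : 𝒜 → ℝ := fun a' => if a' = a then 1 else 0
  have hb : Measurable b := .of_discrete
  let ν : 𝒳 → ℝ := fun x => V.nuY m (x, a)
  have hν : Measurable ν := (V.measurable_nuY m).comp (by fun_prop)
  have hgA : Measurable fun x => (ν x - N x) / V.piA x a := (hν.sub hN).div (V.measurable_piA a)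
  have hgR : Measurable[V.sigmaXA] fun ω => b (V.A ω) / p (V.X ω) :=
    (hb.comp (comap_measurable V.XA).snd).div (hp.comp (comap_measurable V.XA).fst)
  have herror := ((V.isResidual_A a).mul_add_condMeanZero (hR.mul V.sigmaXA_le hgR)
    V.sigmaX_le_sigmaXA V.sigmaXA_le (hgA.comp (comap_measurable V.X)))
  rw [← integral_nuY hcons hign hpos a m, ← sub_eq_zero,
    ← integral_sub hint (integrable_nuY hcons hign hpos a m)]
  refine (herror.congr ?_).integral_eq_zero (hint.sub (integrable_nuY hcons hign hpos a m))
  filter_upwards [hcorrect, ae_piA_pos hpos a] with ω hω hπ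
  have hcell : b (V.A ω) * V.nuY m (V.XA ω) = b (V.A ω) * ν (V.X ω) := by
    by_cases hA : V.A ω = a <;> simp [b, ν, XA, hA]
  refine Eq.trans ?_ (augmented_sub_eq hπ.ne' hcell hω).symm
  by_cases hA : V.A ω = a <;> simp [b, hA, ha]

end Augmentation

end Population

section Measurability

variable {T S E : Type*} [MeasurableSpace T] [MeasurableSpace S] [MeasurableSingletonClass S]
  [DecidableEq S] {f : T → S}

@[fun_prop]
theorem measurable_ite_eq (hf : Measurable f) (s : S) :
    Measurable fun t => if f t = s then (1 : ℝ) else 0 :=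
  .ite (hf (measurableSet_singleton s)) measurable_const measurable_const

@[fun_prop]
theorem measurable_ite_mem [MeasurableSpace E] [Zero E] (hf : Measurable f) (s : Finset S)
    {g : T → E} (hg : Measurable g) : Measurable fun t => if f t ∈ s then g t else 0 :=
  .ite (hf s.measurableSet) hg measurable_const

end Measurability

namespace WorkingModels

section Measurability

variable {𝒳 𝒜 𝒵 ℳ T : Type*} [MeasurableSpace 𝒳] [MeasurableSpace 𝒜] [MeasurableSpace 𝒵]
  [MeasurableSpace ℳ] [MeasurableSpace T] {a : 𝒜} {m : ℳ} (W : WorkingModels 𝒳 𝒵 a m)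
  {β : T → Par W.dMu} {η : T → Par W.dNu} {α : T → Par W.dA} {γ : T → Par W.dM}

@[fun_prop]
theorem measurable_mu_comp {v : T → 𝒳 × 𝒜 × 𝒵 × ℳ} (hβ : Measurable β) (hv : Measurable v) :
    Measurable fun t => W.mu (β t) (v t) :=
  W.measurable_mu.comp (hβ.prodMk hv)

@[fun_prop]
theorem measurable_wMu_comp {v : T → 𝒳 × 𝒜 × 𝒵 × ℳ} (hβ : Measurable β) (hv : Measurable v) :
    Measurable fun t => W.wMu (β t) (v t) :=
  W.measurable_wMu.comp (hβ.prodMk hv)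

@[fun_prop]
theorem measurable_nu_comp {v : T → 𝒳 × 𝒜} (hη : Measurable η) (hv : Measurable v) :
    Measurable fun t => W.nu (η t) (v t) :=
  W.measurable_nu.comp (hη.prodMk hv)

@[fun_prop]
theorem measurable_wNu_comp {v : T → 𝒳 × 𝒜} (hη : Measurable η) (hv : Measurable v) :
    Measurable fun t => W.wNu (η t) (v t) :=
  W.measurable_wNu.comp (hη.prodMk hv)

@[fun_prop]
theorem measurable_pA_comp {x : T → 𝒳} (hα : Measurable α) (hx : Measurable x) (l : 𝒜) :
    Measurable fun t => W.pA (α t) (x t) l :=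
  (W.measurable_pA l).comp (hα.prodMk hx)

@[fun_prop]
theorem measurable_wA_comp {x : T → 𝒳} (hα : Measurable α) (hx : Measurable x) (l : 𝒜) :
    Measurable fun t => W.wA (α t) (x t) l :=
  (W.measurable_wA l).comp (hα.prodMk hx)

@[fun_prop]
theorem measurable_pM_comp {v : T → 𝒳 × 𝒜 × 𝒵} (hγ : Measurable γ) (hv : Measurable v) (l : ℳ) :
    Measurable fun t => W.pM (γ t) (v t) l :=
  (W.measurable_pM l).comp (hγ.prodMk hv)

@[fun_prop]
theorem measurable_wM_comp {v : T → 𝒳 × 𝒜 × 𝒵} (hγ : Measurable γ) (hv : Measurable v) (l : ℳ) :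
    Measurable fun t => W.wM (γ t) (v t) l :=
  (W.measurable_wM l).comp (hγ.prodMk hv)

theorem measurable_dr4 : Measurable (Function.uncurry W.dr4) := by
  unfold dr4
  fun_prop

variable [DecidableEq 𝒜] [MeasurableSingletonClass 𝒜]

theorem measurable_dr1 : Measurable (Function.uncurry W.dr1) := by
  unfold dr1
  fun_prop

variable [DecidableEq ℳ] [MeasurableSingletonClass ℳ]

theorem measurable_dr2 : Measurable (Function.uncurry W.dr2) := by
  unfold dr2
  fun_prop

theorem measurable_dr3 : Measurable (Function.uncurry W.dr3) := by
  unfold dr3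
  fun_prop

theorem measurable_system1 : Measurable (Function.uncurry W.system1) := by
  unfold system1 scoreMu scoreNu respMu scoreA
  simp only [ite_and]
  fun_prop

theorem measurable_system2 : Measurable (Function.uncurry W.system2) := by
  unfold system2 scoreM scoreNu respM scoreA
  fun_prop

theorem measurable_system3 : Measurable (Function.uncurry W.system3) := by
  unfold system3 scoreMu scoreM scoreA
  simp only [ite_and]
  fun_prop

theorem measurable_system4 : Measurable (Function.uncurry W.system4) := by
  unfold system4 scoreMu scoreM scoreNu respMuM
  simp only [ite_and]
  fun_prop

end Measurability

end WorkingModels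

theorem Identified.eq_of_condMeanZero {Ω 𝒪 : Type*} {m mΩ : MeasurableSpace Ω}
    [MeasurableSpace 𝒪] {P : Measure Ω} {o : Ω → 𝒪} {d : ℕ} {U : 𝒪 → Par d → Par d}
    {Θ : Set (Par d)} {t θ : Par d} (h : Identified (P.map o) U Θ θ) (ho : Measurable o)
    (ht : t ∈ Θ) (hU : ∀ j, CondMeanZero m P fun ω => U (o ω) t j) : t = θ := by
  have hint := h.integrable t ht
  have hint' : Integrable (fun ω => U (o ω) t) P := hint.comp_measurable ho
  refine h.unique t ht ?_
  rw [integral_map ho.aemeasurable hint.1]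
  ext j
  let proj : Par d →L[ℝ] ℝ := EuclideanSpace.proj j
  exact (proj.integral_comp_comm hint').symm.trans
    ((hU j).integral_eq_zero (proj.integrable_comp hint'))

namespace WorkingModels

section Scores

variable {Ω 𝒳 𝒜 𝒵 ℳ : Type*} [MeasurableSpace Ω] [MeasurableSpace 𝒳] [MeasurableSpace 𝒜]
  [MeasurableSpace 𝒵] [MeasurableSpace ℳ] {P : Measure Ω} [IsFiniteMeasure P]
  {V : Population Ω 𝒳 𝒜 𝒵 ℳ P} [DecidableEq 𝒜] {a : 𝒜} {m : ℳ}
  {W : WorkingModels 𝒳 𝒵 a m}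

theorem condMeanZero_scoreMu [Finite 𝒜] [MeasurableSingletonClass 𝒜] [Finite ℳ] [DecidableEq ℳ]
    [MeasurableSingletonClass ℳ] (hcons : V.Consistency) {β : Par W.dMu}
    (hβ : ∀ᵐ ω ∂P, V.A ω ∈ W.S → V.M ω ∈ W.T → W.mu β (V.XAZM ω) = V.muY (V.XAZM ω))
    (j : Fin W.dMu) : CondMeanZero V.sigmaXAZM P fun ω => W.scoreMu (V.obs ω) β j := by
  have hw : Measurable fun v : 𝒳 × 𝒜 × 𝒵 × ℳ =>
      if v.2.1 ∈ W.S then if v.2.2.2 ∈ W.T then W.wMu β v j else 0 else 0 := by fun_prop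
  refine ((Population.isResidual_Y hcons).condMeanZero.mul V.sigmaXAZM_le
    (hw.comp (comap_measurable V.XAZM))).congr ?_
  filter_upwards [hβ] with ω hω
  by_cases hA : V.A ω ∈ W.S <;> by_cases hM : V.M ω ∈ W.T <;>
    simp_all [scoreMu, Population.obs, Population.XAZM, mul_comm]

theorem condMeanZero_scoreA [StandardBorelSpace 𝒜] [Nonempty 𝒜] {α : Par W.dA}
    (hα : ∀ᵐ ω ∂P, ∀ l ∈ W.LA, W.pA α (V.X ω) l = V.piA (V.X ω) l) (j : Fin W.dA) :
    CondMeanZero V.sigmaX P fun ω => W.scoreA (V.obs ω) α j := by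
  have hw : ∀ l, Measurable fun x => W.wA α x l j := fun l => by fun_prop
  refine (IsResidual.sum_mul W.LA V.isResidual_A V.sigmaX_le
    fun l => (hw l).comp (comap_measurable V.X)).congr ?_
  filter_upwards [hα] with ω hω
  simp only [scoreA, Population.obs, WithLp.ofLp_sum, Finset.sum_apply, PiLp.smul_apply,
    smul_eq_mul]
  exact Finset.sum_congr rfl fun l hl => by rw [hω l hl, mul_comm]; rfl

theorem condMeanZero_scoreM [MeasurableSingletonClass 𝒜] [DecidableEq ℳ] [StandardBorelSpace ℳ]
    [Nonempty ℳ] {γ : Par W.dM}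
    (hγ : ∀ᵐ ω ∂P, V.A ω ∈ W.S → ∀ l ∈ W.LM, W.pM γ (V.XAZ ω) l = V.piM (V.XAZ ω) l)
    (j : Fin W.dM) : CondMeanZero V.sigmaXAZ P fun ω => W.scoreM (V.obs ω) γ j := by
  have hw : ∀ l, Measurable fun v : 𝒳 × 𝒜 × 𝒵 => if v.2.1 ∈ W.S then W.wM γ v l j else 0 :=
    fun l => by fun_prop
  refine (IsResidual.sum_mul W.LM V.isResidual_M V.sigmaXAZ_le
    fun l => (hw l).comp (comap_measurable V.XAZ)).congr ?_
  filter_upwards [hγ] with ω hω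
  by_cases hA : V.A ω ∈ W.S
  · simp only [scoreM, Population.obs, hA, if_true, WithLp.ofLp_sum, Finset.sum_apply,
      PiLp.smul_apply, smul_eq_mul]
    refine Finset.sum_congr rfl fun l hl => ?_
    rw [← hω hA l hl, mul_comm, Function.comp_apply, if_pos (show (V.XAZ ω).2.1 ∈ W.S from hA)]
    rfl
  · simp [scoreM, Population.obs, Population.XAZ, hA]

theorem condMeanZero_scoreNu [StandardBorelSpace 𝒵] [Nonempty 𝒵] {η : Par W.dNu}
    {u : Obs 𝒳 𝒜 𝒵 ℳ → ℝ}
    (hη : ∀ᵐ ω ∂P, V.A ω ∈ W.S → W.nu η (V.XA ω) = V.nuY m (V.XA ω))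
    (hu : CondMeanZero V.sigmaXA P fun ω =>
      (if V.A ω ∈ W.S then (1 : ℝ) else 0) * (u (V.obs ω) - V.nuY m (V.XA ω)))
    (j : Fin W.dNu) : CondMeanZero V.sigmaXA P fun ω => W.scoreNu u (V.obs ω) η j := by
  have hw : Measurable fun v : 𝒳 × 𝒜 => W.wNu η v j := by fun_prop
  refine (hu.mul V.sigmaXA_le (hw.comp (comap_measurable V.XA))).congr ?_
  filter_upwards [hη] with ω hω
  by_cases hA : V.A ω ∈ W.S <;>
    simp_all [scoreNu, Population.obs, Population.XA, mul_comm]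

end Scores

section FittedModels

variable {Ω 𝒳 𝒜 𝒵 ℳ : Type*} [MeasurableSpace Ω] [MeasurableSpace 𝒳] [MeasurableSpace 𝒜]
  [MeasurableSpace 𝒵] [MeasurableSpace ℳ] {P : Measure Ω} [IsFiniteMeasure P]
  {V : Population Ω 𝒳 𝒜 𝒵 ℳ P} [DecidableEq 𝒜] {a : 𝒜} {m : ℳ}
  {W : WorkingModels 𝒳 𝒵 a m}

theorem pA_eq_piA [StandardBorelSpace 𝒜] [Nonempty 𝒜] {α : Par W.dA}
    (hα : Identified V.law W.scoreA W.ΘA α) (hcorrect : W.PiACorrect V) :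
    ∀ᵐ ω ∂P, W.pA α (V.X ω) a = V.piA (V.X ω) a := by
  obtain ⟨α₀, hmem, htrue⟩ := hcorrect
  have htrue := ae_of_ae_map V.measurable_X.aemeasurable htrue
  obtain rfl := hα.eq_of_condMeanZero V.measurable_obs hmem (condMeanZero_scoreA htrue)
  filter_upwards [htrue] with ω hω using hω a W.a_mem_LA

theorem pM_eq_piM [MeasurableSingletonClass 𝒜] [DecidableEq ℳ] [StandardBorelSpace ℳ]
    [Nonempty ℳ] {γ : Par W.dM} (hγ : Identified V.law W.scoreM W.ΘM γ)
    (hcorrect : W.PiMCorrect V) :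
    ∀ᵐ ω ∂P, V.A ω ∈ W.S → W.pM γ (V.XAZ ω) m = V.piM (V.XAZ ω) m := by
  obtain ⟨γ₀, hmem, htrue⟩ := hcorrect
  have htrue := ae_of_ae_map V.measurable_XAZ.aemeasurable htrue
  obtain rfl := hγ.eq_of_condMeanZero V.measurable_obs hmem (condMeanZero_scoreM htrue)
  filter_upwards [htrue] with ω hω hA using hω hA m W.m_mem_LM

variable [StandardBorelSpace 𝒜] [Nonempty 𝒜] [StandardBorelSpace ℳ] [Nonempty ℳ]

/-- Positivity of the treatment propensity extends the conclusion from the units with `A = a` to all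
units. -/
theorem nu_eq_nuY [StandardBorelSpace 𝒵] [Nonempty 𝒵] (hpos : V.Positivity) {η : Par W.dNu}
    {u : Obs 𝒳 𝒜 𝒵 ℳ → ℝ} (hη : Identified V.law (W.scoreNu u) W.ΘNu η)
    (hcorrect : W.NuCorrect V) (hu : CondMeanZero V.sigmaXA P fun ω =>
      (if V.A ω ∈ W.S then (1 : ℝ) else 0) * (u (V.obs ω) - V.nuY m (V.XA ω))) :
    ∀ᵐ ω ∂P, W.nu η (V.X ω, a) = V.nuY m (V.X ω, a) := by
  obtain ⟨η₀, hmem, htrue⟩ := hcorrect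
  have htrue := ae_of_ae_map V.measurable_XA.aemeasurable htrue
  obtain rfl := hη.eq_of_condMeanZero V.measurable_obs hmem (condMeanZero_scoreNu htrue hu)
  let f : 𝒳 → ℝ := fun x => W.nu η₀ (x, a) - V.nuY m (x, a)
  have hf : Measurable f := by
    have := V.measurable_nuY m
    fun_prop
  have hcell : (fun ω => (if V.A ω = a then (1 : ℝ) else 0) * f (V.X ω)) =ᵐ[P] 0 := by
    filter_upwards [htrue] with ω hω
    by_cases hA : V.A ω = a
    · simpa [f, Population.XA, hA, sub_eq_zero] using hω (hA ▸ W.a_mem_S)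
    · simp [hA]
  filter_upwards [(V.isResidual_A a).ae_eq_zero_of_condMean_pos (.of_ae_eq_zero hcell)
    V.sigmaX_le ((V.measurable_piA a).comp (comap_measurable V.X))
    (Population.ae_piA_pos hpos a) (hf.comp (comap_measurable V.X))] with ω hω
  exact sub_eq_zero.1 hω

/-- The model is fitted where `M = m`; positivity of the mediator propensity extends the conclusion
to all values of `M`. -/
theorem mu_eq_muYAt [Finite 𝒜] [Finite ℳ] [DecidableEq ℳ] (hcons : V.Consistency)
    (hpos : V.Positivity) {β : Par W.dMu} (hβ : Identified V.law W.scoreMu W.ΘMu β)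
    (hcorrect : W.MuCorrect V) :
    ∀ᵐ ω ∂P, V.A ω ∈ W.S → W.mu β (V.X ω, V.A ω, V.Z ω, m) = V.muYAt m (V.XAZ ω) := by
  obtain ⟨β₀, hmem, htrue⟩ := hcorrect
  have htrue := ae_of_ae_map V.measurable_XAZM.aemeasurable htrue
  obtain rfl := hβ.eq_of_condMeanZero V.measurable_obs hmem (condMeanZero_scoreMu hcons htrue)
  let f : 𝒳 × 𝒜 × 𝒵 → ℝ := fun v =>
    if v.2.1 ∈ W.S then W.mu β₀ (v.1, v.2.1, v.2.2, m) - V.muYAt m v else 0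
  have hf : Measurable f := by
    have := V.measurable_muYAt m
    fun_prop
  have hcell : (fun ω => (if V.M ω = m then (1 : ℝ) else 0) * f (V.XAZ ω)) =ᵐ[P] 0 := by
    filter_upwards [htrue] with ω hω
    by_cases hM : V.M ω = m <;> by_cases hA : V.A ω ∈ W.S
    · have hT : V.M ω ∈ W.T := by rw [hM]; exact W.m_mem_T
      have hfit : W.mu β₀ (V.X ω, V.A ω, V.Z ω, m) = V.muY (V.X ω, V.A ω, V.Z ω, m) := by
        simpa only [Population.XAZM, hM] using hω hA hT
      simp [f, hM, hA, Population.XAZ, Population.muYAt, hfit]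
    all_goals simp [f, hM, hA, Population.XAZ]
  filter_upwards [(V.isResidual_M m).ae_eq_zero_of_condMean_pos (.of_ae_eq_zero hcell)
    V.sigmaXAZ_le ((V.measurable_piM m).comp (comap_measurable V.XAZ))
    (Population.ae_piM_pos hpos m) (hf.comp (comap_measurable V.XAZ))] with ω hω hA
  simpa [f, Population.XAZ, hA, sub_eq_zero] using hω

end FittedModels

section Responses

variable {Ω 𝒳 𝒜 𝒵 ℳ : Type*} [MeasurableSpace Ω] [StandardBorelSpace Ω] [MeasurableSpace 𝒳]
  [Finite 𝒜] [DecidableEq 𝒜] [Nonempty 𝒜] [MeasurableSpace 𝒜] [DiscreteMeasurableSpace 𝒜]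
  [MeasurableSpace 𝒵] [StandardBorelSpace 𝒵] [Nonempty 𝒵]
  [Finite ℳ] [Nonempty ℳ] [MeasurableSpace ℳ] [DiscreteMeasurableSpace ℳ]
  {P : Measure Ω} [IsFiniteMeasure P] {V : Population Ω 𝒳 𝒜 𝒵 ℳ P}
  {a : 𝒜} {m : ℳ} {W : WorkingModels 𝒳 𝒵 a m}

theorem integral_eq_psi_of_augmentedNu (hcons : V.Consistency) (hign : V.SequentialIgnorability)
    (hpos : V.Positivity) {u : Obs 𝒳 𝒜 𝒵 ℳ → ℝ} {η : Par W.dNu} {α : Par W.dA}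
    (hη : Identified V.law (W.scoreNu u) W.ΘNu η) (hα : Identified V.law W.scoreA W.ΘA α)
    (hu : CondMeanZero V.sigmaXA P fun ω =>
      (if V.A ω ∈ W.S then (1 : ℝ) else 0) * (u (V.obs ω) - V.nuY m (V.XA ω)))
    (hcorrect : W.NuCorrect V ∨ W.PiACorrect V) {φ : Obs 𝒳 𝒜 𝒵 ℳ → ℝ}
    (hφ : Integrable φ V.law)
    (hφu : ∀ ω, φ (V.obs ω) = W.nu η (V.X ω, a) +
      (if V.A ω = a then (1 : ℝ) else 0) / W.pA α (V.X ω) a *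
        (u (V.obs ω) - W.nu η (V.X ω, a))) :
    ∫ o, φ o ∂V.law = V.psi a m := by
  have hint := hφ.comp_measurable V.measurable_obs
  rw [Population.law, integral_map V.measurable_obs.aemeasurable hφ.1]
  simp only [Function.comp_def, hφu] at hint ⊢
  refine Population.integral_augmented (N := fun x => W.nu η (x, a)) (p := fun x => W.pA α x a)
    hcons hign hpos W.a_mem_S (by fun_prop) (by fun_prop) hu ?_ hint
  rcases hcorrect with hν | hA
  · filter_upwards [nu_eq_nuY hpos hη hν hu] with ω hω using .inl hω
  · filter_upwards [pA_eq_piA hα hA] with ω hω using .inr hω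

variable [DecidableEq ℳ]

theorem condMeanZero_respMuM (hcons : V.Consistency) (hign : V.SequentialIgnorability)
    (hpos : V.Positivity) {β : Par W.dMu} {γ : Par W.dM}
    (hβ : Identified V.law W.scoreMu W.ΘMu β) (hγ : Identified V.law W.scoreM W.ΘM γ)
    (hcorrect : W.PiMCorrect V ∨ W.MuCorrect V) :
    CondMeanZero V.sigmaXA P fun ω => (if V.A ω ∈ W.S then (1 : ℝ) else 0) *
      (W.respMuM β γ (V.obs ω) - V.nuY m (V.XA ω)) := by
  refine Population.condMeanZero_augmentedResponse hcons hign hpos m W.S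
    (μ := fun v => W.mu β (v.1, v.2.1, v.2.2, m)) (p := fun v => W.pM γ v m)
    (by fun_prop) (by fun_prop) ?_
  rcases hcorrect with hM | hμ
  · filter_upwards [pM_eq_piM hγ hM] with ω hω hA using .inr (hω hA)
  · filter_upwards [mu_eq_muYAt hcons hpos hβ hμ] with ω hω hA using .inl (hω hA)

theorem condMeanZero_respMu (hcons : V.Consistency) (hign : V.SequentialIgnorability)
    (hpos : V.Positivity) {β : Par W.dMu} (hβ : Identified V.law W.scoreMu W.ΘMu β)
    (hμ : W.MuCorrect V) :
    CondMeanZero V.sigmaXA P fun ω => (if V.A ω ∈ W.S then (1 : ℝ) else 0) *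
      (W.respMu β (V.obs ω) - V.nuY m (V.XA ω)) := by
  -- The propensity model `0` removes the augmentation term, as division by zero gives zero.
  refine (Population.condMeanZero_augmentedResponse hcons hign hpos m W.S
    (μ := fun v => W.mu β (v.1, v.2.1, v.2.2, m)) (p := 0)
    (by fun_prop) measurable_const ?_).congr ?_
  · filter_upwards [mu_eq_muYAt hcons hpos hβ hμ] with ω hω hA using .inl (hω hA)
  · exact .of_forall fun ω => by simp [respMu, Population.obs, Population.XAZ]

theorem condMeanZero_respM (hcons : V.Consistency) (hign : V.SequentialIgnorability)
    (hpos : V.Positivity) {γ : Par W.dM} (hγ : Identified V.law W.scoreM W.ΘM γ)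
    (hM : W.PiMCorrect V) :
    CondMeanZero V.sigmaXA P fun ω => (if V.A ω ∈ W.S then (1 : ℝ) else 0) *
      (W.respM γ (V.obs ω) - V.nuY m (V.XA ω)) := by
  refine (Population.condMeanZero_augmentedResponse hcons hign hpos m W.S
    (μ := 0) (p := fun v => W.pM γ v m) measurable_const (by fun_prop) ?_).congr ?_
  · filter_upwards [pM_eq_piM hγ hM] with ω hω hA using .inr (hω hA)
  · exact .of_forall fun ω => by
      by_cases hM : V.M ω = m <;>
        simp [respM, Population.obs, Population.XAZ, hM, div_eq_mul_inv, mul_comm]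

theorem integral_dr1 (hcons : V.Consistency) (hign : V.SequentialIgnorability)
    (hpos : V.Positivity) {θ : W.Par1} (hreg : W.Regular1 V.law θ) (hμ : W.MuCorrect V)
    (hνA : W.NuCorrect V ∨ W.PiACorrect V) : ∫ o, W.dr1 o θ ∂V.law = V.psi a m := by
  have : IsFiniteMeasure V.law := Measure.isFiniteMeasure_map P V.obs
  refine integral_eq_psi_of_augmentedNu hcons hign hpos hreg.nu hreg.piA
    (condMeanZero_respMu hcons hign hpos hreg.mu hμ) hνA
    (hreg.regular.memLp_target.integrable one_le_two) fun ω => ?_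
  by_cases hA : V.A ω = a <;> simp [dr1, respMu, Population.obs, hA]

theorem integral_dr2 (hcons : V.Consistency) (hign : V.SequentialIgnorability)
    (hpos : V.Positivity) {θ : W.Par2} (hreg : W.Regular2 V.law θ) (hM : W.PiMCorrect V)
    (hνA : W.NuCorrect V ∨ W.PiACorrect V) : ∫ o, W.dr2 o θ ∂V.law = V.psi a m := by
  have : IsFiniteMeasure V.law := Measure.isFiniteMeasure_map P V.obs
  refine integral_eq_psi_of_augmentedNu hcons hign hpos hreg.nu hreg.piA
    (condMeanZero_respM hcons hign hpos hreg.piM hM) hνA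
    (hreg.regular.memLp_target.integrable one_le_two) fun ω => ?_
  by_cases hA : V.A ω = a <;> simp [dr2, respM, Population.obs, hA]

theorem integral_dr3 (hcons : V.Consistency) (hign : V.SequentialIgnorability)
    (hpos : V.Positivity) {θ : W.Par3} (hreg : W.Regular3 V.law θ) (hA : W.PiACorrect V)
    (hMμ : W.PiMCorrect V ∨ W.MuCorrect V) : ∫ o, W.dr3 o θ ∂V.law = V.psi a m := by
  have : IsFiniteMeasure V.law := Measure.isFiniteMeasure_map P V.obs
  have hφ := hreg.regular.memLp_target.integrable one_le_two
  have hint := hφ.comp_measurable V.measurable_obs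
  have hdr : ∀ ω, W.dr3 (V.obs ω) θ = (0 : 𝒳 → ℝ) (V.X ω) +
      (if V.A ω = a then (1 : ℝ) else 0) / W.pA θ.2.2 (V.X ω) a *
        (W.respMuM θ.1 θ.2.1 (V.obs ω) - (0 : 𝒳 → ℝ) (V.X ω)) := fun ω => by
    by_cases hA : V.A ω = a <;> simp [dr3, respMuM, Population.obs, hA]
  rw [Population.law, integral_map V.measurable_obs.aemeasurable hφ.1]
  simp only [Function.comp_def, hdr] at hint ⊢
  refine Population.integral_augmented hcons hign hpos W.a_mem_S measurable_const
    (p := fun x => W.pA θ.2.2 x a) (by fun_prop)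
    (condMeanZero_respMuM hcons hign hpos hreg.mu hreg.piM hMμ) ?_ hint
  filter_upwards [pA_eq_piA hreg.piA hA] with ω hω using .inr hω

theorem integral_dr4 (hcons : V.Consistency) (hign : V.SequentialIgnorability)
    (hpos : V.Positivity) {θ : W.Par4} (hreg : W.Regular4 V.law θ) (hν : W.NuCorrect V)
    (hMμ : W.PiMCorrect V ∨ W.MuCorrect V) : ∫ o, W.dr4 o θ ∂V.law = V.psi a m := by
  rw [Population.law, integral_map V.measurable_obs.aemeasurable hreg.regular.memLp_target.1,
    ← Population.integral_nuY hcons hign hpos a m]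
  exact integral_congr_ae (nu_eq_nuY hpos hreg.nu hν
    (condMeanZero_respMuM hcons hign hpos hreg.mu hreg.piM hMμ))

end Responses

end WorkingModels

end CRF

theorem proposition1
    {Ω Ω' 𝒳 𝒜 𝒵 ℳ : Type*}
    [MeasurableSpace Ω] [StandardBorelSpace Ω] [MeasurableSpace Ω']
    [MeasurableSpace 𝒳]
    [Fintype 𝒜] [DecidableEq 𝒜] [Nonempty 𝒜] [MeasurableSpace 𝒜] [DiscreteMeasurableSpace 𝒜]
    [MeasurableSpace 𝒵] [StandardBorelSpace 𝒵] [Nonempty 𝒵]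
    [Fintype ℳ] [DecidableEq ℳ] [Nonempty ℳ] [MeasurableSpace ℳ] [DiscreteMeasurableSpace ℳ]
    (P : Measure Ω) [IsProbabilityMeasure P] (V : Population Ω 𝒳 𝒜 𝒵 ℳ P)
    (hcons : V.Consistency) (hign : V.SequentialIgnorability) (hpos : V.Positivity)
    (a : 𝒜) (m : ℳ) (W : WorkingModels 𝒳 𝒵 a m)
    (P' : Measure Ω') [IsProbabilityMeasure P'] (O : ℕ → Ω' → Obs 𝒳 𝒜 𝒵 ℳ)
    (hO : IsSample P' O V.law) :
    (∀ (θ : W.Par1) (θhat : ℕ → Ω' → W.Par1),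
      W.Regular1 V.law θ → IsZEstimator P' O W.system1 θhat θ →
      W.MuCorrect V → (W.NuCorrect V ∨ W.PiACorrect V) →
      IsCAN P' (plugIn O W.dr1 θhat) (V.psi a m)
        (asympVar V.law W.system1 W.dr1 (V.psi a m) θ)) ∧
    (∀ (θ : W.Par2) (θhat : ℕ → Ω' → W.Par2),
      W.Regular2 V.law θ → IsZEstimator P' O W.system2 θhat θ →
      W.PiMCorrect V → (W.NuCorrect V ∨ W.PiACorrect V) →
      IsCAN P' (plugIn O W.dr2 θhat) (V.psi a m)
        (asympVar V.law W.system2 W.dr2 (V.psi a m) θ)) ∧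
    (∀ (θ : W.Par3) (θhat : ℕ → Ω' → W.Par3),
      W.Regular3 V.law θ → IsZEstimator P' O W.system3 θhat θ →
      W.PiACorrect V → (W.PiMCorrect V ∨ W.MuCorrect V) →
      IsCAN P' (plugIn O W.dr3 θhat) (V.psi a m)
        (asympVar V.law W.system3 W.dr3 (V.psi a m) θ)) ∧
    (∀ (θ : W.Par4) (θhat : ℕ → Ω' → W.Par4),
      W.Regular4 V.law θ → IsZEstimator P' O W.system4 θhat θ →
      W.NuCorrect V → (W.PiMCorrect V ∨ W.MuCorrect V) →
      IsCAN P' (plugIn O W.dr4 θhat) (V.psi a m)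
        (asympVar V.law W.system4 W.dr4 (V.psi a m) θ)) := by
  exact ⟨fun θ θhat hreg hz hμ hνA => isCAN_plugIn hO W.measurable_system1 W.measurable_dr1
      hreg.regular hz (WorkingModels.integral_dr1 hcons hign hpos hreg hμ hνA),
    fun θ θhat hreg hz hM hνA => isCAN_plugIn hO W.measurable_system2 W.measurable_dr2
      hreg.regular hz (WorkingModels.integral_dr2 hcons hign hpos hreg hM hνA),
    fun θ θhat hreg hz hA hMμ => isCAN_plugIn hO W.measurable_system3 W.measurable_dr3
      hreg.regular hz (WorkingModels.integral_dr3 hcons hign hpos hreg hA hMμ),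
    fun θ θhat hreg hz hν hMμ => isCAN_plugIn hO W.measurable_system4 W.measurable_dr4
      hreg.regular hz (WorkingModels.integral_dr4 hcons hign hpos hreg hν hMμ)⟩
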